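/- Let $\mathfrak{H}$ be a bicategorically complete $2$-category (every pseudofunctor from a small $2$-category to $\mathfrak H$ has all bilimits weighted by pseudofunctors with values in small categories). Let $\dot{\mathfrak{a}}$ be a small $2$-category with a distinguished object $\mathsf{a}$, and let $\mathrm{t}:\mathfrak{a}\to\dot{\mathfrak{a}}$ be the full inclusion of the sub-$2$-category of all objects other than $\mathsf{a}$. For a pseudofunctor $\mathrm{h}:\mathfrak{x}\to\mathfrak{y}$ between small $2$-categories, the right pseudo-Kan extension of $\mathcal{F}:\mathfrak{x}\to\mathfrak{H}$ along $\mathrm h$ is a pseudofunctor $\mathcal{R}=\mathrm{Ps}\text{-}\mathrm{Ran}_{\mathrm h}\mathcal{F}:\mathfrak{y}\to\mathfrak{H}$ with a pseudonatural transformation $\varepsilon:\mathcal{R}\circ\mathrm{h}\to\mathcal{F}$ such that for every pseudofunctor $\mathcal{S}:\mathfrak{y}\to\mathfrak{H}$ the functor $[\mathfrak{y},\mathfrak{H}]_{PS}(\mathcal{S},\mathcal{R})\to[\mathfrak{x},\mathfrak{H}]_{PS}(\mathcal{S}\circ\mathrm{h},\mathcal{F})$, $\beta\mapsto\varepsilon\cdot(\beta\mathrm{h})$,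 is an equivalence of categories. A pseudofunctor $\mathcal{D}:\mathfrak{y}\to\mathfrak{H}$ is of effective $\mathrm{h}$-descent if the unit $\eta_{\mathcal{D}}:\mathcal{D}\to\mathrm{Ps}\text{-}\mathrm{Ran}_{\mathrm{h}}(\mathcal{D}\circ\mathrm{h})$ (the pseudonatural transformation, unique up to isomorphism, with $\varepsilon\cdot(\eta_{\mathcal{D}}\mathrm{h})\cong\mathrm{id}$) is an equivalence in $[\mathfrak{y},\mathfrak{H}]_{PS}$. A $1$-cell $f:\mathsf{a}\to b$ of $\dot{\mathfrak{a}}$ is $\mathrm{t}$-irreducible if $b\neq\mathsf{a}$ and $f$ is not of the form $h\circ k$ with $k:\mathsf{a}\to c$, $h:c\to b$ and $c\neq\mathsf{a}$, $c\neq b$. An object $c\neq\mathsf{a}$ is a $\mathrm{t}$-pure structure object if for every $1$-cell $g:\mathsf{a}\to c$ there are an object $b\neq c$, a $\mathrm{t}$-irreducible $f:\mathsf{a}\to b$ and $g':b\to c$ with $g=g'\circ f$. Let $\mathrm{i}_{\mathrm t}:\mathfrak{I}_{\mathrm t}\to\dot{\mathfrak{a}}$ be the full inclusion of the objects that are not $\mathrm{t}$-pure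 structure objects (so $\mathsf{a}\in\mathfrak{I}_{\mathrm t}$), let $\mathsf{2}=\{0\to1\}$, and let $\mathrm{g}_{\mathrm t}$ be the full inclusion into $\mathfrak{I}_{\mathrm t}\times\mathsf{2}$ of all objects other than $(\mathsf{a},0)$. Let $\mathcal{A},\mathcal{B}:\dot{\mathfrak{a}}\to\mathfrak{H}$ be pseudofunctors and $\alpha:\mathcal{A}\to\mathcal{B}$ a pseudonatural transformation that is objectwise fully faithful (for every object $x$ of $\dot{\mathfrak a}$ and every object $Z$ of $\mathfrak{H}$ the functor $\mathfrak{H}(Z,\alpha_x)$ is fully faithful). Let $\mathcal{C}_\alpha:\dot{\mathfrak{a}}\times\mathsf{2}\to\mathfrak{H}$ be the mate of $\alpha$: the pseudofunctor with $\mathcal{C}_\alpha(x,0)=\mathcal{A}(x)$, $\mathcal{C}_\alpha(x,1)=\mathcal{B}(x)$, which restricts to $\mathcal A$ and $\mathcal B$ over $0$ and $1$ and sends $(f:x\to y,\,0\to1)$ to $\alpha_y\circ\mathcal{A}(f)$, with the coherence $2$-cells induced by those of $\mathcal{A}$, $\mathcal{B}$ and $\alpha$. Assume that $\mathcal{B}$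 is of effective $\mathrm{t}$-descent. Then $\mathcal{A}$ is of effective $\mathrm{t}$-descent if and only if $\mathcal{C}_\alpha\circ(\mathrm{i}_{\mathrm t}\times\mathrm{Id}_{\mathsf{2}}):\mathfrak{I}_{\mathrm t}\times\mathsf{2}\to\mathfrak{H}$ is of effective $\mathrm{g}_{\mathrm t}$-descent. -/

import Mathlib

open CategoryTheory Bicategory
open scoped Pseudofunctor.StrongTrans

universe s w w₁ w₂ w₃ w₄ v v₁ v₂ v₃ v₄ u u₁ u₂ u₃ u₄

namespace Descent

section Restriction

variable {J : Type u₁} [Bicategory.{w₁, v₁} J] {K : Type u₂} [Bicategory.{w₂, v₂} K]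
  {H : Type u₃} [Bicategory.{w₃, v₃} H]

/-- Restriction of a pseudonatural transformation `η : F ⟶ G` along a pseudofunctor `t`. -/
def whisker (t : J ⥤ᵖ K) {F G : K ⥤ᵖ H} (η : F ⟶ G) : t.comp F ⟶ t.comp G where
  app x := η.app (t.obj x)
  naturality f := η.naturality (t.map f)
  naturality_naturality θ := η.naturality_naturality (t.map₂ θ)
  naturality_id x := by
    have h1 := η.naturality_naturality (t.mapId x).hom
    have h2 := η.naturality_id (t.obj x)
    have h3 : (η.naturality (t.map (𝟙 x))).hom ≫
          η.app (t.obj x) ◁ (G.map₂ (t.mapId x).hom ≫ (G.mapId (t.obj x)).hom) =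
        (F.map₂ (t.mapId x).hom ≫ (F.mapId (t.obj x)).hom) ▷ η.app (t.obj x) ≫
          (λ_ (η.app (t.obj x))).hom ≫ (ρ_ (η.app (t.obj x))).inv := by
      rw [whiskerLeft_comp, comp_whiskerRight, ← Category.assoc, ← h1, Category.assoc, h2,
        Category.assoc]
    exact h3
  naturality_comp f g := by
    have h1 := η.naturality_naturality (t.mapComp f g).hom
    have h2 := η.naturality_comp (t.map f) (t.map g)
    have h3 := congrArg (fun z => z ≫ η.app _ ◁ (G.mapComp (t.map f) (t.map g)).hom) h1
    have h4 := congrArg (fun z => F.map₂ (t.mapComp f g).hom ▷ η.app _ ≫ z) h2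
    simp only [Category.assoc] at h3
    have h5 := h3.symm.trans h4
    rw [← whiskerLeft_comp, ← Category.assoc (F.map₂ _ ▷ _), ← comp_whiskerRight] at h5
    exact h5

/-- The functor `[K, H](F, G) ⥤ [J, H](F ∘ t, G ∘ t)` given by restriction along `t`. -/
def restrict (t : J ⥤ᵖ K) (F G : K ⥤ᵖ H) : (F ⟶ G) ⥤ (t.comp F ⟶ t.comp G) where
  obj η := whisker t η
  map Γ := ⟨{ app := fun x => Γ.as.app (t.obj x)
              naturality := fun f => Γ.as.naturality (t.map f) }⟩

end Restriction

section Representable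

variable {H : Type u} [Bicategory.{w, v} H]

/-- The covariant representable pseudofunctor `H(X, -)`. -/
def corep (X : H) : H ⥤ᵖ Cat.{w, v} where
  toPrelaxFunctor := PrelaxFunctor.mkOfHomFunctors (fun Y => Cat.of (X ⟶ Y))
    (fun Y Z => postcomposingCat X Y Z)
  mapId Y := rightUnitorNatIsoCat X Y
  mapComp f g := (associatorNatIsoLeftCat X f g).symm
  map₂_whisker_left {a b c} f g g' η := by
    refine Cat.Hom₂.ext (NatTrans.ext (funext fun (h : X ⟶ a) => ?_))
    change h ◁ (f ◁ η) = (α_ h f g).inv ≫ (h ≫ f) ◁ η ≫ (α_ h f g').hom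
    simp
  map₂_whisker_right {a b c} f f' η g := by
    refine Cat.Hom₂.ext (NatTrans.ext (funext fun (h : X ⟶ a) => ?_))
    change h ◁ (η ▷ g) = (α_ h f g).inv ≫ (h ◁ η) ▷ g ≫ (α_ h f' g).hom
    simp
  map₂_associator {a b c d} f g k := by
    refine Cat.Hom₂.ext (NatTrans.ext (funext fun (h : X ⟶ a) => ?_))
    change h ◁ (α_ f g k).hom = (α_ h (f ≫ g) k).inv ≫ (α_ h f g).inv ▷ k ≫ 𝟙 (((h ≫ f) ≫ g) ≫ k) ≫
      (α_ (h ≫ f) g k).hom ≫ (α_ h f (g ≫ k)).hom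
    simp
  map₂_left_unitor {a b} f := by
    refine Cat.Hom₂.ext (NatTrans.ext (funext fun (h : X ⟶ a) => ?_))
    change h ◁ (λ_ f).hom = (α_ h (𝟙 a) f).inv ≫ (ρ_ h).hom ▷ f ≫ 𝟙 (h ≫ f)
    simp
  map₂_right_unitor {a b} f := by
    refine Cat.Hom₂.ext (NatTrans.ext (funext fun (h : X ⟶ a) => ?_))
    change h ◁ (ρ_ f).hom = (α_ h f (𝟙 b)).inv ≫ (ρ_ (h ≫ f)).hom ≫ 𝟙 (h ≫ f)
    simp

/-- The functor `H(X, L) ⥤ [H, Cat](H(L, -), H(X, -))` given by precomposition. -/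
def corepMap (X L : H) : (X ⟶ L) ⥤ (corep L ⟶ corep X) where
  obj f :=
    { app := fun Y => (precomposingCat X L Y).obj f
      naturality := fun g => (associatorNatIsoMiddleCat f g).symm
      naturality_naturality := fun {a b g g'} η => by
        refine Cat.Hom₂.ext (NatTrans.ext (funext fun (h : L ⟶ a) => ?_))
        change f ◁ (h ◁ η) ≫ (α_ f h g').inv = (α_ f h g).inv ≫ (f ≫ h) ◁ η
        simp
      naturality_id := fun Y => by
        refine Cat.Hom₂.ext (NatTrans.ext (funext fun (h : L ⟶ Y) => ?_))
        change (α_ f h (𝟙 Y)).inv ≫ (ρ_ (f ≫ h)).hom =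
          f ◁ (ρ_ h).hom ≫ 𝟙 (f ≫ h) ≫ 𝟙 (f ≫ h)
        simp
      naturality_comp := fun {a b c} g k => by
        refine Cat.Hom₂.ext (NatTrans.ext (funext fun (h : L ⟶ a) => ?_))
        change (α_ f h (g ≫ k)).inv ≫ (α_ (f ≫ h) g k).inv =
          f ◁ (α_ h g k).inv ≫ 𝟙 (f ≫ (h ≫ g) ≫ k) ≫ (α_ f (h ≫ g) k).inv ≫
            𝟙 ((f ≫ h ≫ g) ≫ k) ≫ (α_ f h g).inv ▷ k ≫ 𝟙 (((f ≫ h) ≫ g) ≫ k)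
        simp }
  map {f f'} θ := ⟨{ app := fun Y => (precomposingCat X L Y).map θ
                     naturality := fun {a b} g => by
                      refine Cat.Hom₂.ext (NatTrans.ext (funext fun (h : L ⟶ a) => ?_))
                      change θ ▷ (h ≫ g) ≫ (α_ f' h g).inv = (α_ f h g).inv ≫ (θ ▷ h) ▷ g
                      simp }⟩
  map_id f := by
    refine Pseudofunctor.StrongTrans.homCategory.ext fun Y =>
      Cat.Hom₂.ext (NatTrans.ext (funext fun (h : L ⟶ Y) => ?_))
    exact id_whiskerRight f h
  map_comp θ θ' := by
    refine Pseudofunctor.StrongTrans.homCategory.ext fun Y =>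
      Cat.Hom₂.ext (NatTrans.ext (funext fun (h : L ⟶ Y) => ?_))
    exact comp_whiskerRight θ θ' h

end Representable

section Mate

variable {K : Type u₁} [Bicategory.{w₁, v₁} K] {H : Type u₂} [Bicategory.{w₂, v₂} H]

/-- The ordinal `2 = {0 → 1}`, seen as a locally discrete 2-category. -/
abbrev Two : Type := LocallyDiscrete (Fin 2)

theorem not_one_hom_zero (u : (⟨1⟩ : Two) ⟶ ⟨0⟩) : False :=
  absurd (leOfHom u.as) (by decide)

/-- The objects `C(x, 0) = A x` and `C(x, 1) = B x`. -/
def mateObj (A B : K ⥤ᵖ H) (x : K) : Two → H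
  | ⟨0⟩ => A.obj x
  | ⟨1⟩ => B.obj x

/-- `C(f, 0 → 0) = A f`, `C(f, 1 → 1) = B f`, and `C(f : x ⟶ y, 0 → 1) = α_y ∘ A f`. -/
def mateMap {A B : K ⥤ᵖ H} (α : A ⟶ B) {x y : K} (f : x ⟶ y) :
    (i j : Two) → (i ⟶ j) → (mateObj A B x i ⟶ mateObj A B y j)
  | ⟨0⟩, ⟨0⟩, _ => A.map f
  | ⟨0⟩, ⟨1⟩, _ => A.map f ≫ α.app y
  | ⟨1⟩, ⟨1⟩, _ => B.map f
  | ⟨1⟩, ⟨0⟩, u => (not_one_hom_zero u).elim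

/-- The action of the mate of `α` on 2-cells. -/
def mateMap₂ {A B : K ⥤ᵖ H} (α : A ⟶ B) {x y : K} {f g : x ⟶ y} (θ : f ⟶ g) :
    (i j : Two) → (u u' : i ⟶ j) → (mateMap α f i j u ⟶ mateMap α g i j u')
  | ⟨0⟩, ⟨0⟩, _, _ => A.map₂ θ
  | ⟨0⟩, ⟨1⟩, _, _ => A.map₂ θ ▷ α.app y
  | ⟨1⟩, ⟨1⟩, _, _ => B.map₂ θ
  | ⟨1⟩, ⟨0⟩, u, _ => (not_one_hom_zero u).elim

/-- The unit constraints of the mate of `α`. -/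
def mateMapId {A B : K ⥤ᵖ H} (α : A ⟶ B) (x : K) :
    (i : Two) → (mateMap α (𝟙 x) i i (𝟙 i) ≅ 𝟙 (mateObj A B x i))
  | ⟨0⟩ => A.mapId x
  | ⟨1⟩ => B.mapId x

/-- The composition constraints of the mate of `α`; the constraint of `α` enters when the first
1-cell lies over `0 → 1`. -/
def mateMapComp {A B : K ⥤ᵖ H} (α : A ⟶ B) {x y z : K} (f : x ⟶ y) (g : y ⟶ z) :
    (i j k : Two) → (u : i ⟶ j) → (u' : j ⟶ k) →
      (mateMap α (f ≫ g) i k (u ≫ u') ≅ mateMap α f i j u ≫ mateMap α g j k u')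
  | ⟨0⟩, ⟨0⟩, ⟨0⟩, _, _ => A.mapComp f g
  | ⟨0⟩, ⟨0⟩, ⟨1⟩, _, _ =>
      whiskerRightIso (A.mapComp f g) (α.app z) ≪≫ α_ (A.map f) (A.map g) (α.app z)
  | ⟨0⟩, ⟨1⟩, ⟨1⟩, _, _ =>
      whiskerRightIso (A.mapComp f g) (α.app z) ≪≫ α_ (A.map f) (A.map g) (α.app z) ≪≫
        whiskerLeftIso (A.map f) (α.naturality g) ≪≫ (α_ (A.map f) (α.app y) (B.map g)).symm
  | ⟨1⟩, ⟨1⟩, ⟨1⟩, _, _ => B.mapComp f g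
  | ⟨0⟩, ⟨1⟩, ⟨0⟩, _, u => (not_one_hom_zero u).elim
  | ⟨1⟩, ⟨1⟩, ⟨0⟩, _, u => (not_one_hom_zero u).elim
  | ⟨1⟩, ⟨0⟩, ⟨0⟩, u, _ => (not_one_hom_zero u).elim
  | ⟨1⟩, ⟨0⟩, ⟨1⟩, u, _ => (not_one_hom_zero u).elim

/-- The mate `C_α : K × 2 ⥤ᵖ H` of a pseudonatural transformation `α : A ⟶ B`. -/
def mate {A B : K ⥤ᵖ H} (α : A ⟶ B) : K × Two ⥤ᵖ H where
  obj p := mateObj A B p.1 p.2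
  map {p q} f := mateMap α f.1 p.2 q.2 f.2
  map₂ {p q f g} θ := mateMap₂ α θ.1 p.2 q.2 f.2 g.2
  map₂_id {p q} f := by
    obtain ⟨x, i⟩ := p
    obtain ⟨y, j⟩ := q
    obtain ⟨f, u⟩ := f
    match i, j, u with
    | ⟨0⟩, ⟨0⟩, _ => exact A.map₂_id f
    | ⟨0⟩, ⟨1⟩, _ => 
      change A.map₂ (𝟙 f) ▷ α.app y = 𝟙 (A.map f ≫ α.app y)
      simp
    | ⟨1⟩, ⟨1⟩, _ => exact B.map₂_id f
    | ⟨1⟩, ⟨0⟩, u => exact (not_one_hom_zero u).elim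
  map₂_comp {p q f g h} θ θ' := by
    obtain ⟨x, i⟩ := p
    obtain ⟨y, j⟩ := q
    obtain ⟨f, u⟩ := f
    obtain ⟨g, u'⟩ := g
    obtain ⟨h, u''⟩ := h
    obtain ⟨θ, _⟩ := θ
    obtain ⟨θ', _⟩ := θ'
    match i, j, u with
    | ⟨0⟩, ⟨0⟩, _ => exact A.map₂_comp θ θ'
    | ⟨0⟩, ⟨1⟩, _ =>
      change A.map₂ (θ ≫ θ') ▷ α.app y = A.map₂ θ ▷ α.app y ≫ A.map₂ θ' ▷ α.app y
      simp
    | ⟨1⟩, ⟨1⟩, _ => exact B.map₂_comp θ θ'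
    | ⟨1⟩, ⟨0⟩, u => exact (not_one_hom_zero u).elim
  mapId p := mateMapId α p.1 p.2
  mapComp {p q r} f g := mateMapComp α f.1 g.1 p.2 q.2 r.2 f.2 g.2
  map₂_whisker_left {p q r} f g g' θ := by
    obtain ⟨x, i⟩ := p
    obtain ⟨y, j⟩ := q
    obtain ⟨z, k⟩ := r
    obtain ⟨f, u⟩ := f
    obtain ⟨g, u'⟩ := g
    obtain ⟨g', u''⟩ := g'
    obtain ⟨θ, t⟩ := θ
    dsimp only at f g g' u u' u'' θ t
    match i, j, k, u, u' with
    | ⟨0⟩, ⟨0⟩, ⟨0⟩, _, _ => exact A.map₂_whisker_left f θ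
    | ⟨0⟩, ⟨0⟩, ⟨1⟩, _, _ =>
      change A.map₂ (f ◁ θ) ▷ α.app z =
        ((A.mapComp f g).hom ▷ α.app z ≫ (α_ (A.map f) (A.map g) (α.app z)).hom) ≫
          A.map f ◁ (A.map₂ θ ▷ α.app z) ≫
            (α_ (A.map f) (A.map g') (α.app z)).inv ≫ (A.mapComp f g').inv ▷ α.app z
      simp
    | ⟨0⟩, ⟨1⟩, ⟨1⟩, _, _ =>
      change A.map₂ (f ◁ θ) ▷ α.app z =
        ((A.mapComp f g).hom ▷ α.app z ≫ (α_ (A.map f) (A.map g) (α.app z)).hom ≫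
          A.map f ◁ (α.naturality g).hom ≫ (α_ (A.map f) (α.app y) (B.map g)).inv) ≫
          (A.map f ≫ α.app y) ◁ B.map₂ θ ≫
            (((α_ (A.map f) (α.app y) (B.map g')).hom ≫ A.map f ◁ (α.naturality g').inv) ≫
              (α_ (A.map f) (A.map g') (α.app z)).inv) ≫ (A.mapComp f g').inv ▷ α.app z
      have key : (α.naturality g).hom ≫ α.app y ◁ B.map₂ θ ≫ (α.naturality g').inv =
          A.map₂ θ ▷ α.app z := by
        rw [← Pseudofunctor.StrongTrans.naturality_naturality_assoc, Iso.hom_inv_id,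
          Category.comp_id]
      simp [← key]
    | ⟨1⟩, ⟨1⟩, ⟨1⟩, _, _ => exact B.map₂_whisker_left f θ
    | ⟨0⟩, ⟨1⟩, ⟨0⟩, _, u => exact (not_one_hom_zero u).elim
    | ⟨1⟩, ⟨1⟩, ⟨0⟩, _, u => exact (not_one_hom_zero u).elim
    | ⟨1⟩, ⟨0⟩, ⟨0⟩, u, _ => exact (not_one_hom_zero u).elim
    | ⟨1⟩, ⟨0⟩, ⟨1⟩, u, _ => exact (not_one_hom_zero u).elim
  map₂_whisker_right {p q r} f f' θ g := by
    obtain ⟨x, i⟩ := p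
    obtain ⟨y, j⟩ := q
    obtain ⟨z, k⟩ := r
    obtain ⟨f, u⟩ := f
    obtain ⟨f', u''⟩ := f'
    obtain ⟨g, u'⟩ := g
    obtain ⟨θ, t⟩ := θ
    dsimp only at f f' g u u' u'' θ t
    match i, j, k, u, u' with
    | ⟨0⟩, ⟨0⟩, ⟨0⟩, _, _ => exact A.map₂_whisker_right θ g
    | ⟨0⟩, ⟨0⟩, ⟨1⟩, _, _ =>
      change A.map₂ (θ ▷ g) ▷ α.app z =
        ((A.mapComp f g).hom ▷ α.app z ≫ (α_ (A.map f) (A.map g) (α.app z)).hom) ≫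
          A.map₂ θ ▷ (A.map g ≫ α.app z) ≫
            (α_ (A.map f') (A.map g) (α.app z)).inv ≫ (A.mapComp f' g).inv ▷ α.app z
      simp
    | ⟨0⟩, ⟨1⟩, ⟨1⟩, _, _ =>
      change A.map₂ (θ ▷ g) ▷ α.app z =
        ((A.mapComp f g).hom ▷ α.app z ≫ (α_ (A.map f) (A.map g) (α.app z)).hom ≫
          A.map f ◁ (α.naturality g).hom ≫ (α_ (A.map f) (α.app y) (B.map g)).inv) ≫
          (A.map₂ θ ▷ α.app y) ▷ B.map g ≫
            (((α_ (A.map f') (α.app y) (B.map g)).hom ≫ A.map f' ◁ (α.naturality g).inv) ≫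
              (α_ (A.map f') (A.map g) (α.app z)).inv) ≫ (A.mapComp f' g).inv ▷ α.app z
      simp only [Category.assoc]
      rw [← associator_inv_naturality_left_assoc, whisker_exchange_assoc]
      simp
    | ⟨1⟩, ⟨1⟩, ⟨1⟩, _, _ => exact B.map₂_whisker_right θ g
    | ⟨0⟩, ⟨1⟩, ⟨0⟩, _, u => exact (not_one_hom_zero u).elim
    | ⟨1⟩, ⟨1⟩, ⟨0⟩, _, u => exact (not_one_hom_zero u).elim
    | ⟨1⟩, ⟨0⟩, ⟨0⟩, u, _ => exact (not_one_hom_zero u).elim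
    | ⟨1⟩, ⟨0⟩, ⟨1⟩, u, _ => exact (not_one_hom_zero u).elim
  map₂_associator {p q r s} f g h := by
    obtain ⟨x, i⟩ := p
    obtain ⟨y, j⟩ := q
    obtain ⟨z, k⟩ := r
    obtain ⟨t, l⟩ := s
    obtain ⟨f, u⟩ := f
    obtain ⟨g, u'⟩ := g
    obtain ⟨h, u''⟩ := h
    dsimp only at f g h u u' u''
    match i, j, k, l, u, u', u'' with
    | ⟨0⟩, ⟨0⟩, ⟨0⟩, ⟨0⟩, _, _, _ => exact A.map₂_associator f g h
    | ⟨0⟩, ⟨0⟩, ⟨0⟩, ⟨1⟩, _, _, _ =>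
      change A.map₂ (α_ f g h).hom ▷ α.app t =
        ((A.mapComp (f ≫ g) h).hom ▷ α.app t ≫ (α_ (A.map (f ≫ g)) (A.map h) (α.app t)).hom) ≫
          (A.mapComp f g).hom ▷ (A.map h ≫ α.app t) ≫
          (α_ (A.map f) (A.map g) (A.map h ≫ α.app t)).hom ≫
          A.map f ◁ ((α_ (A.map g) (A.map h) (α.app t)).inv ≫ (A.mapComp g h).inv ▷ α.app t) ≫
          (α_ (A.map f) (A.map (g ≫ h)) (α.app t)).inv ≫ (A.mapComp f (g ≫ h)).inv ▷ α.app t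
      simp
    | ⟨0⟩, ⟨0⟩, ⟨1⟩, ⟨1⟩, _, _, _ =>
      change A.map₂ (α_ f g h).hom ▷ α.app t =
        ((A.mapComp (f ≫ g) h).hom ▷ α.app t ≫ (α_ (A.map (f ≫ g)) (A.map h) (α.app t)).hom ≫
          A.map (f ≫ g) ◁ (α.naturality h).hom ≫
          (α_ (A.map (f ≫ g)) (α.app z) (B.map h)).inv) ≫
          ((A.mapComp f g).hom ▷ α.app z ≫ (α_ (A.map f) (A.map g) (α.app z)).hom) ▷ B.map h ≫
          (α_ (A.map f) (A.map g ≫ α.app z) (B.map h)).hom ≫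
          A.map f ◁ ((((α_ (A.map g) (α.app z) (B.map h)).hom ≫ A.map g ◁ (α.naturality h).inv) ≫
              (α_ (A.map g) (A.map h) (α.app t)).inv) ≫ (A.mapComp g h).inv ▷ α.app t) ≫
          (α_ (A.map f) (A.map (g ≫ h)) (α.app t)).inv ≫ (A.mapComp f (g ≫ h)).inv ▷ α.app t
      simp only [comp_whiskerRight, Category.assoc]
      rw [← associator_inv_naturality_left_assoc, whisker_exchange_assoc]
      simp
    | ⟨0⟩, ⟨1⟩, ⟨1⟩, ⟨1⟩, _, _, _ =>
      change A.map₂ (α_ f g h).hom ▷ α.app t =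
        ((A.mapComp (f ≫ g) h).hom ▷ α.app t ≫ (α_ (A.map (f ≫ g)) (A.map h) (α.app t)).hom ≫
          A.map (f ≫ g) ◁ (α.naturality h).hom ≫
          (α_ (A.map (f ≫ g)) (α.app z) (B.map h)).inv) ≫
          ((A.mapComp f g).hom ▷ α.app z ≫ (α_ (A.map f) (A.map g) (α.app z)).hom ≫
            A.map f ◁ (α.naturality g).hom ≫ (α_ (A.map f) (α.app y) (B.map g)).inv) ▷ B.map h ≫
          (α_ (A.map f ≫ α.app y) (B.map g) (B.map h)).hom ≫
          (A.map f ≫ α.app y) ◁ (B.mapComp g h).inv ≫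
          (((α_ (A.map f) (α.app y) (B.map (g ≫ h))).hom ≫
            A.map f ◁ (α.naturality (g ≫ h)).inv) ≫
              (α_ (A.map f) (A.map (g ≫ h)) (α.app t)).inv) ≫
            (A.mapComp f (g ≫ h)).inv ▷ α.app t
      rw [Pseudofunctor.StrongTrans.naturality_comp_inv]
      simp only [comp_whiskerRight, Category.assoc]
      rw [← associator_inv_naturality_left_assoc, whisker_exchange_assoc]
      simp
    | ⟨1⟩, ⟨1⟩, ⟨1⟩, ⟨1⟩, _, _, _ => exact B.map₂_associator f g h
    | ⟨0⟩, ⟨0⟩, ⟨1⟩, ⟨0⟩, _, _, u => exact (not_one_hom_zero u).elim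
    | ⟨0⟩, ⟨1⟩, ⟨0⟩, ⟨0⟩, _, u, _ => exact (not_one_hom_zero u).elim
    | ⟨0⟩, ⟨1⟩, ⟨0⟩, ⟨1⟩, _, u, _ => exact (not_one_hom_zero u).elim
    | ⟨0⟩, ⟨1⟩, ⟨1⟩, ⟨0⟩, _, _, u => exact (not_one_hom_zero u).elim
    | ⟨1⟩, ⟨0⟩, ⟨0⟩, ⟨0⟩, u, _, _ => exact (not_one_hom_zero u).elim
    | ⟨1⟩, ⟨0⟩, ⟨0⟩, ⟨1⟩, u, _, _ => exact (not_one_hom_zero u).elim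
    | ⟨1⟩, ⟨0⟩, ⟨1⟩, ⟨0⟩, u, _, _ => exact (not_one_hom_zero u).elim
    | ⟨1⟩, ⟨0⟩, ⟨1⟩, ⟨1⟩, u, _, _ => exact (not_one_hom_zero u).elim
    | ⟨1⟩, ⟨1⟩, ⟨0⟩, ⟨0⟩, _, u, _ => exact (not_one_hom_zero u).elim
    | ⟨1⟩, ⟨1⟩, ⟨0⟩, ⟨1⟩, _, u, _ => exact (not_one_hom_zero u).elim
    | ⟨1⟩, ⟨1⟩, ⟨1⟩, ⟨0⟩, _, _, u => exact (not_one_hom_zero u).elim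
  map₂_left_unitor {p q} f := by
    obtain ⟨x, i⟩ := p
    obtain ⟨y, j⟩ := q
    obtain ⟨f, u⟩ := f
    dsimp only at f u
    match i, j, u with
    | ⟨0⟩, ⟨0⟩, _ => exact A.map₂_left_unitor f
    | ⟨0⟩, ⟨1⟩, _ =>
      change A.map₂ (λ_ f).hom ▷ α.app y =
        ((A.mapComp (𝟙 x) f).hom ▷ α.app y ≫ (α_ (A.map (𝟙 x)) (A.map f) (α.app y)).hom) ≫
          (A.mapId x).hom ▷ (A.map f ≫ α.app y) ≫ (λ_ (A.map f ≫ α.app y)).hom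
      simp
    | ⟨1⟩, ⟨1⟩, _ => exact B.map₂_left_unitor f
    | ⟨1⟩, ⟨0⟩, u => exact (not_one_hom_zero u).elim
  map₂_right_unitor {p q} f := by
    obtain ⟨x, i⟩ := p
    obtain ⟨y, j⟩ := q
    obtain ⟨f, u⟩ := f
    dsimp only at f u
    match i, j, u with
    | ⟨0⟩, ⟨0⟩, _ => exact A.map₂_right_unitor f
    | ⟨0⟩, ⟨1⟩, _ =>
      change A.map₂ (ρ_ f).hom ▷ α.app y =
        ((A.mapComp f (𝟙 y)).hom ▷ α.app y ≫ (α_ (A.map f) (A.map (𝟙 y)) (α.app y)).hom ≫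
          A.map f ◁ (α.naturality (𝟙 y)).hom ≫ (α_ (A.map f) (α.app y) (B.map (𝟙 y))).inv) ≫
          (A.map f ≫ α.app y) ◁ (B.mapId y).hom ≫ (ρ_ (A.map f ≫ α.app y)).hom
      rw [Pseudofunctor.StrongTrans.naturality_id_hom]
      simp
    | ⟨1⟩, ⟨1⟩, _ => exact B.map₂_right_unitor f
    | ⟨1⟩, ⟨0⟩, u => exact (not_one_hom_zero u).elim

end Mate

section ProdMap

variable {J : Type u₁} [Bicategory.{w₁, v₁} J] {K : Type u₂} [Bicategory.{w₂, v₂} K]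
  {J' : Type u₃} [Bicategory.{w₃, v₃} J'] {K' : Type u₄} [Bicategory.{w₄, v₄} K']

/-- The product `F × G : J × J' ⥤ᵖ K × K'` of two pseudofunctors. -/
def prodMap (F : J ⥤ᵖ K) (G : J' ⥤ᵖ K') : J × J' ⥤ᵖ K × K' where
  obj p := (F.obj p.1, G.obj p.2)
  map f := (F.map f.1, G.map f.2)
  map₂ θ := (F.map₂ θ.1, G.map₂ θ.2)
  map₂_id f := Prod.ext (F.map₂_id f.1) (G.map₂_id f.2)
  map₂_comp θ θ' := Prod.ext (F.map₂_comp θ.1 θ'.1) (G.map₂_comp θ.2 θ'.2)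
  mapId p := Iso.prod (F.mapId p.1) (G.mapId p.2)
  mapComp f g := Iso.prod (F.mapComp f.1 g.1) (G.mapComp f.2 g.2)
  map₂_whisker_left f _ _ θ :=
    Prod.ext (F.map₂_whisker_left f.1 θ.1) (G.map₂_whisker_left f.2 θ.2)
  map₂_whisker_right θ f :=
    Prod.ext (F.map₂_whisker_right θ.1 f.1) (G.map₂_whisker_right θ.2 f.2)
  map₂_associator f g h :=
    Prod.ext (F.map₂_associator f.1 g.1 h.1) (G.map₂_associator f.2 g.2 h.2)
  map₂_left_unitor f := Prod.ext (F.map₂_left_unitor f.1) (G.map₂_left_unitor f.2)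
  map₂_right_unitor f := Prod.ext (F.map₂_right_unitor f.1) (G.map₂_right_unitor f.2)

end ProdMap

section Small

/-- A 2-category with objects in `Type s` is small (relative to the size `s`) if the 1-cells
between any two objects, and the 2-cells between any two 1-cells, are in bijection with a type in
`Type s`. -/
class IsSmallTwoCategory (K : Type s) [Bicategory.{w, v} K] : Prop where
  small_hom (x y : K) : Small.{s} (x ⟶ y)
  small_hom₂ {x y : K} (f g : x ⟶ y) : Small.{s} (f ⟶ g)

/-- A category is small (relative to `s`) if its objects, and the morphisms between any two of
them, are in bijection with a type in `Type s`. -/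
def IsSmallCategory (C : Cat.{w, v}) : Prop :=
  Small.{s} C ∧ ∀ x y : C, Small.{s} (x ⟶ y)

end Small

section Bilimit

variable {J : Type s} [Bicategory.{w, v} J] {H : Type u} [Bicategory.{w, v} H]

/-- A pseudonatural transformation `ρ : W ⟶ H(L, F -)` induces, for every object `X`, the functor
`H(X, L) ⥤ [J, Cat](W, H(X, F -))`, `f ↦ H(f, F -) ∘ ρ`. -/
def coneComparison (W : J ⥤ᵖ Cat.{w, v}) (F : J ⥤ᵖ H) {L : H} (ρ : W ⟶ F.comp (corep L))
    (X : H) : (X ⟶ L) ⥤ (W ⟶ F.comp (corep X)) :=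
  corepMap X L ⋙ restrict F (corep L) (corep X) ⋙ precomp (F.comp (corep X)) ρ

/-- `(L, ρ)` is a `W`-weighted bilimit of `F`. -/
def IsWeightedBilimit (W : J ⥤ᵖ Cat.{w, v}) (F : J ⥤ᵖ H) (L : H) (ρ : W ⟶ F.comp (corep L)) :
    Prop :=
  ∀ X : H, (coneComparison W F ρ X).IsEquivalence

end Bilimit

/-- A 2-category `H` is bicategorically complete (relative to the size `s`) if every pseudofunctor
`F : J ⥤ᵖ H` from a small 2-category has a `W`-weighted bilimit, for every weight `W` with values
in small categories. -/
class BicategoricallyComplete (H : Type u) [Bicategory.{w, v} H] : Prop where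
  exists_bilimit (J : Type s) [Bicategory.{w, v} J] [Strict J] [IsSmallTwoCategory.{s} J]
    (W : J ⥤ᵖ Cat.{w, v}) (_ : ∀ j, IsSmallCategory.{s} (W.obj j)) (F : J ⥤ᵖ H) :
    ∃ (L : H) (ρ : W ⟶ F.comp (corep L)), IsWeightedBilimit W F L ρ

section Kan

variable {J : Type u₁} [Bicategory.{w₁, v₁} J] {K : Type u₂} [Bicategory.{w₂, v₂} K]
  {H : Type u₃} [Bicategory.{w₃, v₃} H]

/-- A 1-cell of a bicategory is an equivalence. -/
def IsEquivalenceCell {H : Type u} [Bicategory.{w, v} H] {X Y : H} (f : X ⟶ Y) : Prop :=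
  ∃ e : X ≌ Y, e.hom = f

/-- For `κ : R ∘ t ⟶ F`, the functor `[K, H](S, R) ⥤ [J, H](S ∘ t, F)`, `β ↦ κ ∘ (β t)`. -/
def kanComparison (t : J ⥤ᵖ K) (F : J ⥤ᵖ H) {R : K ⥤ᵖ H} (κ : t.comp R ⟶ F) (S : K ⥤ᵖ H) :
    (S ⟶ R) ⥤ (t.comp S ⟶ F) :=
  restrict t S R ⋙ postcomp (t.comp S) κ

/-- `(R, κ)` is a right pseudo-Kan extension of `F` along `t`. -/
def IsRightPseudoKan (t : J ⥤ᵖ K) (F : J ⥤ᵖ H) (R : K ⥤ᵖ H) (κ : t.comp R ⟶ F) : Prop :=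
  ∀ S : K ⥤ᵖ H, (kanComparison t F κ S).IsEquivalence

/-- `A : K ⥤ᵖ H` is of effective `t`-descent: the unit `η : A ⟶ Ran_t (A ∘ t)` of the idempotent
pseudomonad `Ran_t (- ∘ t)` given by right pseudo-Kan extension along `t` is an equivalence of the
2-category `[K, H]` at `A`, that is, `A` carries a pseudoalgebra structure. The unit
is the 1-cell, unique up to isomorphism, whose image under the universal property of
`Ran_t (A ∘ t)` is the identity of `A ∘ t`. -/
def IsEffectiveDescent (t : J ⥤ᵖ K) (A : K ⥤ᵖ H) : Prop :=
  ∃ (R : K ⥤ᵖ H) (κ : t.comp R ⟶ t.comp A) (η : A ⟶ R),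
    IsRightPseudoKan t (t.comp A) R κ ∧
      Nonempty ((kanComparison t (t.comp A) κ A).obj η ≅ 𝟙 (t.comp A)) ∧ IsEquivalenceCell η

/-- A 1-cell is fully faithful if so are its images under all covariant representables. -/
def IsFullyFaithfulCell {X Y : H} (f : X ⟶ Y) : Prop :=
  ∀ Z : H, (postcomp Z f).Full ∧ (postcomp Z f).Faithful

/-- A pseudonatural transformation is objectwise fully faithful. -/
def IsObjectwiseFullyFaithful {A B : K ⥤ᵖ H} (α : A ⟶ B) : Prop :=
  ∀ x : K, IsFullyFaithfulCell (α.app x)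

end Kan

section Pure

variable {K : Type u} [Bicategory.{w, v} K]

/-- The full sub-2-category on the objects satisfying `P`. -/
abbrev FullSub (P : K → Prop) : Type u :=
  InducedBicategory K (Subtype.val : {x : K // P x} → K)

/-- The full inclusion 2-functor. -/
def fullInclusion (P : K → Prop) : FullSub P ⥤ᵖ K :=
  (InducedBicategory.forget (C := K) (F := (Subtype.val : {x : K // P x} → K))).toPseudofunctor

/-- The full inclusion into `K` of the full sub-2-category of all objects other than `a`. -/
abbrev puncturedInclusion (a : K) : FullSub (fun x : K => x ≠ a) ⥤ᵖ K :=
  fullInclusion (fun x : K => x ≠ a)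

/-- A 1-cell `f : a ⟶ b` is irreducible if `b ≠ a` and `f` does not factor through any object `c`
different from `a` and `b`. -/
def IsIrreducibleCell {a b : K} (f : a ⟶ b) : Prop :=
  b ≠ a ∧ ∀ c : K, c ≠ a → c ≠ b → ∀ (k : a ⟶ c) (h : c ⟶ b), k ≫ h ≠ f

/-- `c ≠ a` is a pure structure object if every 1-cell `g : a ⟶ c` factors through an
irreducible 1-cell `f : a ⟶ b` with `b ≠ c`. -/
def IsPureStructure (a c : K) : Prop :=
  c ≠ a ∧ ∀ g : a ⟶ c, ∃ (b : K) (f : a ⟶ b) (g' : b ⟶ c),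
    b ≠ c ∧ IsIrreducibleCell f ∧ f ≫ g' = g

/-- The full sub-2-category of the objects that are not pure structure objects. It contains `a`. -/
abbrev NonPure (a : K) : Type u := FullSub (fun x : K => ¬ IsPureStructure a x)

/-- The object `a` of `NonPure a`. -/
def NonPure.base (a : K) : NonPure a := (⟨a, fun h => h.1 rfl⟩ : {x : K // ¬ IsPureStructure a x})

/-- The full inclusion `NonPure a ⥤ᵖ K`. -/
abbrev nonPureInclusion (a : K) : NonPure a ⥤ᵖ K := fullInclusion _

/-- The full inclusion of all objects of `NonPure a × Two` other than `(a, 0)`. -/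
abbrev nonPureProdInclusion (a : K) :=
  puncturedInclusion ((NonPure.base a, ⟨0⟩) : NonPure a × Two)

end Pure

end Descent

/-! Since `α` is objectwise fully faithful, a transformation into `A` amounts to a transformation
into `B` whose components factor through those of `α` (`IsObjectwiseFullyFaithful.full_postcomp`,
`IsObjectwiseFullyFaithful.exists_comp_iso`). Effective descent of `A` along `t` says that
restriction `[S, A] → [S t, A t]` is an equivalence for every `S` (`isEffectiveDescent_iff`), so Kan
extensions drop out. When `B` is of effective descent, `A` is so if and only if the following holds
(`isEffectiveDescent_iff_factors`):

(*) if `b : X ⟶ B a` is such that `b ≫ B g` factors through `α_x` for all `g : a ⟶ x` with `x ≠ a`,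
then `b` factors through `α_a`.

Given (*), a transformation `S t ⟶ A t` is pushed into `B t` and extended to `S ⟶ B`; by naturality
its component at `a` satisfies the hypothesis of (*), so the extension lifts to `A`. Conversely, the
1-cells into `B k` subject to the hypothesis of (*) are represented by a fully faithful `L k ⟶ B k`,
an intersection of pullbacks built as a bilimit (`exists_intersection`). The `L k` form a
pseudofunctor `S` over `B` (`exists_liftPseudofunctor`). Away from `a` it maps into `A`, and descent
for `A` extends this to `S ⟶ A` over `B`; hence whatever factors through `L a` factors through `A
a`.

The theorem uses this criterion twice. The restricted mate `C` embeds into `(x, i) ↦ C (x, 1) = B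
x`, by a cell isomorphic to `α_x` for `i = 0` and to an identity for `i = 1`. The target is of
effective descent for formal reasons (`isEffectiveDescent_of_unit`): it inverts the cells `(x, i) ⟶
(x, 1)`, and `(x, 1)` is never the missing object `(a, 0)`. For this embedding (*) becomes (*) for
`α` with `x` ranging over non-pure objects only. That changes nothing (`liftsAway_iff_nonPure`): a
1-cell into a pure structure object passes through an irreducible one, whose target is not pure. -/

namespace Descent

/-! ### Factorisation through fully faithful 1-cells. -/

section Lifting

variable {H : Type u₂} [Bicategory.{w₂, v₂} H]

namespace IsFullyFaithfulCell

variable {X Y Z : H} {f : X ⟶ Y} {g h : Z ⟶ X}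

theorem whiskerRight_injective (hf : IsFullyFaithfulCell f) {θ θ' : g ⟶ h}
    (e : θ ▷ f = θ' ▷ f) : θ = θ' :=
  (hf Z).2.map_injective e

/-- The 2-cell `g ⟶ h` lifting a given 2-cell along a fully faithful 1-cell. -/
noncomputable def lift (hf : IsFullyFaithfulCell f) (θ : g ≫ f ⟶ h ≫ f) : g ⟶ h :=
  ((hf Z).1.map_surjective θ).choose

theorem lift_whiskerRight (hf : IsFullyFaithfulCell f) (θ : g ≫ f ⟶ h ≫ f) : hf.lift θ ▷ f = θ :=
  ((hf Z).1.map_surjective θ).choose_spec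

/-- The invertible 2-cell lifting a given invertible 2-cell along a fully faithful 1-cell. -/
@[simps]
noncomputable def liftIso (hf : IsFullyFaithfulCell f) (θ : g ≫ f ≅ h ≫ f) : g ≅ h where
  hom := hf.lift θ.hom
  inv := hf.lift θ.inv
  hom_inv_id := hf.whiskerRight_injective (by simp [lift_whiskerRight])
  inv_hom_id := hf.whiskerRight_injective (by simp [lift_whiskerRight])

end IsFullyFaithfulCell

/-- The 1-cell `b` factors through `f` up to an invertible 2-cell. -/
def Factors {X Y Z : H} (f : X ⟶ Y) (b : Z ⟶ Y) : Prop :=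
  ∃ g : Z ⟶ X, Nonempty (g ≫ f ≅ b)

end Lifting

/-! ### Lifting modifications and transformations along an objectwise fully faithful `α`. -/

section Transformations

open Pseudofunctor.StrongTrans

variable {K : Type u₁} [Bicategory.{w₁, v₁} K] {H : Type u₂} [Bicategory.{w₂, v₂} H]
  {A B S : K ⥤ᵖ H} {α : A ⟶ B}

theorem naturality_comp_app (φ : S ⟶ A) (α : A ⟶ B) {k l : K} (f : k ⟶ l) :
    (φ ≫ α).naturality f = (α_ _ _ _).symm ≪≫ whiskerRightIso (φ.naturality f) (α.app l) ≪≫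
      α_ _ _ _ ≪≫ whiskerLeftIso (φ.app k) (α.naturality f) ≪≫ (α_ _ _ _).symm := by
  rfl

theorem IsObjectwiseFullyFaithful.faithful_postcomp (hα : IsObjectwiseFullyFaithful α) :
    (postcomp S α).Faithful where
  map_injective {φ ψ _ _} h := homCategory.ext fun k =>
    (hα k).whiskerRight_injective
      (congrArg (fun Θ : (φ ≫ α) ⟶ (ψ ≫ α) => Θ.as.app k) h)

theorem IsObjectwiseFullyFaithful.full_postcomp (hα : IsObjectwiseFullyFaithful α) :
    (postcomp S α).Full where
  map_surjective {φ ψ} (Γ : (φ ≫ α) ⟶ (ψ ≫ α)) := by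
    have hΓ : ∀ k, ∃ θ : φ.app k ⟶ ψ.app k, θ ▷ α.app k = Γ.as.app k :=
      fun k => ⟨(hα k).lift _, (hα k).lift_whiskerRight _⟩
    choose θ hθ using hΓ
    refine ⟨⟨{ app := θ, naturality := fun {k l} f => ?_ }⟩, homCategory.ext hθ⟩
    -- After whiskering with `α_l`, the modification axiom for `θ` becomes that of `Γ` with the
    -- constraint of `α` cancelled.
    apply (hα l).whiskerRight_injective
    have h := Γ.as.naturality f
    rw [← hθ k, ← hθ l, naturality_comp_app, naturality_comp_app] at h
    rw [← cancel_epi (α_ _ _ _).inv, ← cancel_mono ((α_ _ _ _).hom ≫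
      ψ.app k ◁ (α.naturality f).hom ≫ (α_ _ _ _).inv)]
    simp at h ⊢
    rw [h, associator_naturality_left_assoc, ← whisker_exchange_assoc]
    simp

/-- The naturality constraint, after composition with a fully faithful `α`, of a lift along `α`
of the pseudonatural transformation `φ`. -/
def liftNaturality (φ : S ⟶ B) (α : A ⟶ B) {σ : ∀ k, S.obj k ⟶ A.obj k}
    (e : ∀ k, σ k ≫ α.app k ≅ φ.app k) {k l : K} (f : k ⟶ l) :
    (S.map f ≫ σ l) ≫ α.app l ≅ (σ k ≫ A.map f) ≫ α.app l :=
  α_ _ _ _ ≪≫ whiskerLeftIso (S.map f) (e l) ≪≫ φ.naturality f ≪≫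
    whiskerRightIso (e k).symm (B.map f) ≪≫ α_ _ _ _ ≪≫
      whiskerLeftIso (σ k) (α.naturality f).symm ≪≫ (α_ _ _ _).symm

/-- The lift of a pseudonatural transformation `φ` along an objectwise fully faithful `α` through
which all components of `φ` factor. -/
noncomputable def liftTrans (hα : IsObjectwiseFullyFaithful α) (φ : S ⟶ B)
    {σ : ∀ k, S.obj k ⟶ A.obj k} (e : ∀ k, σ k ≫ α.app k ≅ φ.app k) : S ⟶ A where
  app := σ
  naturality {k l} f := (hα l).liftIso (liftNaturality φ α e f)
  -- Each axiom is an equation of 2-cells into `A`, so it may be checked after whiskering with `α`,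
  -- where it follows from the axioms of `φ` and `α`.
  naturality_naturality {k l f g} θ := (hα l).whiskerRight_injective (by
    have h2 := α.naturality_naturality θ
    rw [← Iso.eq_comp_inv, Category.assoc] at h2
    simp [IsFullyFaithfulCell.lift_whiskerRight, liftNaturality, h2]
    rw [associator_naturality_left_assoc, ← whisker_exchange_assoc,
      φ.naturality_naturality_assoc, whisker_exchange_assoc]
    simp)
  naturality_id k := (hα k).whiskerRight_injective (by
    simp [IsFullyFaithfulCell.lift_whiskerRight, liftNaturality, naturality_id_hom,
      naturality_id_inv]
    rw [associator_naturality_left_assoc, whisker_exchange_assoc, whisker_exchange_assoc]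
    simp)
  naturality_comp {k l m} f g := (hα m).whiskerRight_injective (by
    -- In the composition axiom the constraint at `f` is whiskered with `A.map g` before `α`. An
    -- opaque `ν`, known only through `ν ▷ α`, keeps it from being unfolded until `α` has been moved
    -- next to it.
    obtain ⟨ν, hν⟩ : ∃ ν : S.map f ≫ σ l ⟶ σ k ≫ A.map f,
        ν ▷ α.app l = (liftNaturality φ α e f).hom :=
      ⟨_, (hα l).lift_whiskerRight _⟩
    have e1 : ((hα l).liftIso (liftNaturality φ α e f)).hom = ν :=
      (hα l).whiskerRight_injective (hν ▸ (hα l).lift_whiskerRight _)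
    rw [e1]
    simp [IsFullyFaithfulCell.lift_whiskerRight, liftNaturality, naturality_comp_hom,
      naturality_comp_inv] at hν ⊢
    rw [associator_naturality_left_assoc, ← associator_inv_naturality_left_assoc,
      associator_inv_naturality_right_assoc, whisker_exchange_assoc, whisker_exchange_assoc,
      whisker_exchange_assoc ν, whiskerRight_comp ν, hν]
    simp)

/-- The lift of `φ` along `α` composes with `α` to `φ`. -/
noncomputable def liftTransCompIso (hα : IsObjectwiseFullyFaithful α) (φ : S ⟶ B)
    {σ : ∀ k, S.obj k ⟶ A.obj k} (e : ∀ k, σ k ≫ α.app k ≅ φ.app k) :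
    liftTrans hα φ e ≫ α ≅ φ :=
  isoMk e (fun {k l} f => by
    have h : S.map f ◁ (e l).hom ≫ (φ.naturality f).hom =
        ((α_ (S.map f) (σ l) (α.app l)).inv ≫
          (hα l).lift (liftNaturality φ α e f).hom ▷ α.app l ≫
          (α_ (σ k) (A.map f) (α.app l)).hom ≫ σ k ◁ (α.naturality f).hom ≫
            (α_ (σ k) (α.app k) (B.map f)).inv) ≫ (e k).hom ▷ B.map f := by
      rw [IsFullyFaithfulCell.lift_whiskerRight]
      simp [liftNaturality]
    exact h)

theorem IsObjectwiseFullyFaithful.exists_comp_iso (hα : IsObjectwiseFullyFaithful α) (φ : S ⟶ B)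
    (h : ∀ k, Factors (α.app k) (φ.app k)) : ∃ σ : S ⟶ A, Nonempty (σ ≫ α ≅ φ) := by
  choose σ e using h
  exact ⟨_, ⟨liftTransCompIso hα φ fun k => (e k).some⟩⟩

end Transformations

/-! ### Pseudofunctors cut out of `B` by fully faithful 1-cells. -/

section LiftPseudofunctor

open Pseudofunctor.StrongTrans IsFullyFaithfulCell

variable {K : Type u₁} [Bicategory.{w₁, v₁} K] {H : Type u₂} [Bicategory.{w₂, v₂} H]
  {B : K ⥤ᵖ H} {S : K → H} {j : ∀ k, S k ⟶ B.obj k}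
  {σ : ∀ {k l : K}, (k ⟶ l) → (S k ⟶ S l)}

/-- The action on 2-cells of the pseudofunctor lifting `B` along fully faithful 1-cells. -/
noncomputable def liftMap₂ (hj : ∀ k, IsFullyFaithfulCell (j k))
    (e : ∀ {k l : K} (f : k ⟶ l), σ f ≫ j l ≅ j k ≫ B.map f) {k l : K} {f g : k ⟶ l}
    (θ : f ⟶ g) : σ f ⟶ σ g :=
  (hj l).lift ((e f).hom ≫ j k ◁ B.map₂ θ ≫ (e g).inv)

theorem liftMap₂_whiskerRight (hj : ∀ k, IsFullyFaithfulCell (j k))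
    (e : ∀ {k l : K} (f : k ⟶ l), σ f ≫ j l ≅ j k ≫ B.map f) {k l : K} {f g : k ⟶ l}
    (θ : f ⟶ g) : liftMap₂ hj e θ ▷ j l = (e f).hom ≫ j k ◁ B.map₂ θ ≫ (e g).inv :=
  (hj l).lift_whiskerRight _

/-- The composition constraint, after composition with `j`, of the pseudofunctor lifting `B`
along `j`. -/
def liftMapCompAux (e : ∀ {k l : K} (f : k ⟶ l), σ f ≫ j l ≅ j k ≫ B.map f) {k l m : K}
    (f : k ⟶ l) (g : l ⟶ m) : σ (f ≫ g) ≫ j m ≅ (σ f ≫ σ g) ≫ j m :=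
  e (f ≫ g) ≪≫ whiskerLeftIso (j k) (B.mapComp f g) ≪≫ (α_ _ _ _).symm ≪≫
    whiskerRightIso (e f).symm (B.map g) ≪≫ α_ _ _ _ ≪≫ whiskerLeftIso (σ f) (e g).symm ≪≫
      (α_ _ _ _).symm

/-- The pseudofunctor with values `S k` lifting `B` along fully faithful 1-cells
`j k : S k ⟶ B k`, when each `B f` restricts to some `σ f` along them. -/
noncomputable def liftPseudofunctor (hj : ∀ k, IsFullyFaithfulCell (j k))
    (e : ∀ {k l : K} (f : k ⟶ l), σ f ≫ j l ≅ j k ≫ B.map f) : K ⥤ᵖ H where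
  obj := S
  map := σ
  map₂ := liftMap₂ hj e
  map₂_id f := (hj _).whiskerRight_injective (by simp [liftMap₂_whiskerRight])
  map₂_comp θ θ' := (hj _).whiskerRight_injective (by simp [liftMap₂_whiskerRight])
  mapId k := (hj k).liftIso (e (𝟙 k) ≪≫ whiskerLeftIso (j k) (B.mapId k) ≪≫ ρ_ _ ≪≫ (λ_ _).symm)
  mapComp {k l m} f g := (hj m).liftIso (liftMapCompAux e f g)
  map₂_whisker_left {k l m} f g g' θ := (hj m).whiskerRight_injective (by
    simp [liftMap₂_whiskerRight, liftMapCompAux, lift_whiskerRight]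
    rw [associator_inv_naturality_right_assoc, whisker_exchange_assoc]
    simp)
  map₂_whisker_right {k l m} f f' θ g := (hj m).whiskerRight_injective (by
    simp [liftMap₂_whiskerRight, liftMapCompAux, lift_whiskerRight]
    rw [associator_naturality_left_assoc, ← whisker_exchange_assoc, whiskerRight_comp,
      liftMap₂_whiskerRight]
    simp)
  map₂_associator {k l m n} f g h := (hj n).whiskerRight_injective (by
    -- As for transformations, a constraint that occurs whiskered by another 1-cell is made opaque
    -- and used only through its whiskering with `j`.
    have hν := (hj m).lift_whiskerRight (liftMapCompAux e f g).hom
    simp only [liftIso_hom]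
    generalize (hj m).lift (liftMapCompAux e f g).hom = ν at hν ⊢
    simp [liftMap₂_whiskerRight, liftMapCompAux, lift_whiskerRight] at hν ⊢
    rw [associator_naturality_left_assoc, ← associator_naturality_right_assoc,
      ← whisker_exchange_assoc, whiskerRight_comp ν, hν, associator_inv_naturality_right_assoc,
      whisker_exchange_assoc]
    simp)
  map₂_left_unitor {k l} f := (hj l).whiskerRight_injective (by
    have hν := (hj k).lift_whiskerRight
      (e (𝟙 k) ≪≫ whiskerLeftIso (j k) (B.mapId k) ≪≫ ρ_ _ ≪≫ (λ_ _).symm).hom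
    simp only [liftIso_hom]
    generalize (hj k).lift _ = ν at hν ⊢
    simp [liftMap₂_whiskerRight, liftMapCompAux, lift_whiskerRight] at hν ⊢
    rw [associator_naturality_left_assoc, Iso.inv_hom_id_assoc, whisker_exchange_assoc,
      whiskerRight_comp, hν]
    simp)
  map₂_right_unitor {k l} f := (hj l).whiskerRight_injective (by
    simp [liftMap₂_whiskerRight, liftMapCompAux, lift_whiskerRight]
    rw [associator_inv_naturality_right_assoc (σ f), Iso.hom_inv_id_assoc,
      ← whisker_exchange_assoc]
    simp)

/-- The 1-cells `j k` form a pseudonatural transformation into `B`. -/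
noncomputable def liftPseudofunctorTrans (hj : ∀ k, IsFullyFaithfulCell (j k))
    (e : ∀ {k l : K} (f : k ⟶ l), σ f ≫ j l ≅ j k ≫ B.map f) : liftPseudofunctor hj e ⟶ B where
  app := j
  naturality := e
  naturality_naturality {k l f g} θ := by
    have h : liftMap₂ hj e θ ▷ j l ≫ (e g).hom = (e f).hom ≫ j k ◁ B.map₂ θ := by
      simp [liftMap₂_whiskerRight]
    exact h
  naturality_id k := by
    have h : (e (𝟙 k)).hom ≫ j k ◁ (B.mapId k).hom =
        (hj k).lift (e (𝟙 k) ≪≫ whiskerLeftIso (j k) (B.mapId k) ≪≫ ρ_ _ ≪≫ (λ_ _).symm).hom ▷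
          j k ≫ (λ_ (j k)).hom ≫ (ρ_ (j k)).inv := by
      simp [lift_whiskerRight]
    exact h
  naturality_comp {k l m} f g := by
    have h : (e (f ≫ g)).hom ≫ j k ◁ (B.mapComp f g).hom =
        (hj m).lift (liftMapCompAux e f g).hom ▷ j m ≫ (α_ (σ f) (σ g) (j m)).hom ≫
          σ f ◁ (e g).hom ≫ (α_ (σ f) (j l) (B.map g)).inv ≫ (e f).hom ▷ B.map g ≫
            (α_ (j k) (B.map f) (B.map g)).hom := by
      simp [lift_whiskerRight, liftMapCompAux]
    exact h

/-- The conclusion records only which 1-cells factor through `β`; the components of `β` are in fact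
the `j k`, but nothing more is needed later. -/
theorem exists_liftPseudofunctor (B : K ⥤ᵖ H) (j : ∀ k, S k ⟶ B.obj k)
    (hj : ∀ k, IsFullyFaithfulCell (j k))
    (h : ∀ {k l : K} (f : k ⟶ l), Factors (j l) (j k ≫ B.map f)) :
    ∃ (R : K ⥤ᵖ H) (β : R ⟶ B), ∀ (k : K) (Z : H) (b : Z ⟶ B.obj k),
      Factors (β.app k) b ↔ Factors (j k) b := by
  choose σ e using @h
  exact ⟨_, liftPseudofunctorTrans hj (fun f => (e f).some), fun _ _ _ => Iff.rfl⟩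

end LiftPseudofunctor


/-! ### Effective descent as a property of restriction functors. -/

section Restriction

open Pseudofunctor.StrongTrans

variable {J : Type u₁} [Bicategory.{w₁, v₁} J] {K : Type u₂} [Bicategory.{w₂, v₂} K]
  {H : Type u₃} [Bicategory.{w₃, v₃} H]

/-- Postcomposition with `p` and then `q` is naturally isomorphic to the identity if `p ≫ q` is. -/
def postcompPostcompIso {X Y Z : H} {p : Y ⟶ Z} {q : Z ⟶ Y} (i : p ≫ q ≅ 𝟙 Y) :
    postcomp X p ⋙ postcomp X q ≅ 𝟭 (X ⟶ Y) :=
  NatIso.ofComponents (fun g => α_ g p q ≪≫ whiskerLeftIso g i ≪≫ ρ_ g) (fun {f g} θ => by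
    have h : (θ ▷ p) ▷ q ≫ (α_ g p q).hom ≫ g ◁ i.hom ≫ (ρ_ g).hom =
        ((α_ f p q).hom ≫ f ◁ i.hom ≫ (ρ_ f).hom) ≫ θ := by
      rw [associator_naturality_left_assoc, ← whisker_exchange_assoc]
      simp
    exact h)

theorem isEquivalence_postcomp {X Y Z : H} {f : Y ⟶ Z} (hf : IsEquivalenceCell f) :
    (postcomp X f).IsEquivalence := by
  obtain ⟨e, rfl⟩ := hf
  exact Functor.IsEquivalence.mk' _ (postcompPostcompIso e.unit.symm).symm
    (postcompPostcompIso e.counit)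

/-- Restriction along `t` commutes with postcomposition. -/
def postcompRestrictIso (t : J ⥤ᵖ K) (S : K ⥤ᵖ H) {A B : K ⥤ᵖ H} (α : A ⟶ B) :
    postcomp S α ⋙ restrict t S B ≅ restrict t S A ⋙ postcomp (t.comp S) (whisker t α) :=
  Iso.refl _

/-- If `κ` restricts `η` to the identity, then restriction along `t` is the comparison functor of
`κ` after postcomposition with `η`. -/
def postcompKanComparisonIso {t : J ⥤ᵖ K} {A R : K ⥤ᵖ H} {κ : t.comp R ⟶ t.comp A} {η : A ⟶ R}
    (i : (kanComparison t (t.comp A) κ A).obj η ≅ 𝟙 (t.comp A)) (S : K ⥤ᵖ H) :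
    postcomp S η ⋙ kanComparison t (t.comp A) κ S ≅ restrict t S A :=
  NatIso.ofComponents
    (fun β => α_ (whisker t β) (whisker t η) κ ≪≫ whiskerLeftIso (whisker t β) i ≪≫ ρ_ _)
    (fun {_ _} Γ => (postcompPostcompIso i).hom.naturality ((restrict t S A).map Γ))

/-- Restriction is the Kan comparison functor composed with postcomposition by the unit, so it is an
equivalence when the unit is. Conversely, if restriction is always an equivalence, then `A` with
identities is its own Kan extension. No existence theorem for Kan extensions is involved. -/
theorem isEffectiveDescent_iff (t : J ⥤ᵖ K) (A : K ⥤ᵖ H) :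
    IsEffectiveDescent t A ↔ ∀ S : K ⥤ᵖ H, (restrict t S A).IsEquivalence := by
  constructor
  · rintro ⟨R, κ, η, hκ, ⟨i⟩, hη⟩ S
    have := hκ S
    have := isEquivalence_postcomp (X := S) hη
    exact Functor.isEquivalence_of_iso (postcompKanComparisonIso i S)
  · intro h
    refine ⟨A, 𝟙 _, 𝟙 _, fun S => ?_, ⟨ρ_ (𝟙 (t.comp A))⟩, Bicategory.Equivalence.id A, rfl⟩
    have := h S
    exact Functor.isEquivalence_of_iso
      (Functor.isoWhiskerLeft (restrict t S A) (rightUnitorNatIso (t.comp S) (t.comp A))).symm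

end Restriction

/-! ### The descent criterion (*) for a fully faithful `α : A ⟶ B`. -/

section Criterion

variable {K : Type u₁} [Bicategory.{w₁, v₁} K] {H : Type u₂} [Bicategory.{w₂, v₂} H]
  {A B : K ⥤ᵖ H} {α : A ⟶ B}

theorem IsObjectwiseFullyFaithful.whisker {J : Type u₃} [Bicategory.{w₃, v₃} J]
    (hα : IsObjectwiseFullyFaithful α) (t : J ⥤ᵖ K) :
    IsObjectwiseFullyFaithful (whisker t α) :=
  fun x => hα (t.obj x)

theorem Factors.of_iso {X Y Z : H} {f : X ⟶ Y} {b b' : Z ⟶ Y} (h : Factors f b) (e : b ≅ b') :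
    Factors f b' :=
  let ⟨g, ⟨i⟩⟩ := h
  ⟨g, ⟨i ≪≫ e⟩⟩

/-- The component at `k` of an invertible modification. -/
def isoApp {S : K ⥤ᵖ H} {φ ψ : S ⟶ B} (e : φ ≅ ψ) (k : K) : φ.app k ≅ ψ.app k where
  hom := e.hom.as.app k
  inv := e.inv.as.app k
  hom_inv_id := congrArg (fun Γ : φ ⟶ φ => Γ.as.app k) e.hom_inv_id
  inv_hom_id := congrArg (fun Γ : ψ ⟶ ψ => Γ.as.app k) e.inv_hom_id

theorem Factors.precomp {X Y Z W : H} {f : X ⟶ Y} {b : Z ⟶ Y} (h : Factors f b) (g : W ⟶ Z) :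
    Factors f (g ≫ b) :=
  let ⟨u, ⟨i⟩⟩ := h
  ⟨g ≫ u, ⟨α_ _ _ _ ≪≫ whiskerLeftIso g i⟩⟩

theorem Factors.naturality (α : A ⟶ B) {k l : K} {Z : H} {b : Z ⟶ B.obj k}
    (h : Factors (α.app k) b) (f : k ⟶ l) : Factors (α.app l) (b ≫ B.map f) :=
  let ⟨u, ⟨i⟩⟩ := h
  ⟨u ≫ A.map f, ⟨α_ _ _ _ ≪≫ whiskerLeftIso u (α.naturality f) ≪≫ (α_ _ _ _).symm ≪≫
    whiskerRightIso i (B.map f)⟩⟩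

/-- Given a 1-cell `b : Z ⟶ B a`, all its images under the 1-cells from `a` to other objects
lift along `α`. -/
def LiftsAway (α : A ⟶ B) (a : K) {Z : H} {k : K} (b : Z ⟶ B.obj k) : Prop :=
  ∀ x : K, x ≠ a → ∀ g : k ⟶ x, Factors (α.app x) (b ≫ B.map g)

theorem LiftsAway.comp {a : K} {Z : H} {k l : K} {b : Z ⟶ B.obj k}
    (h : LiftsAway α a b) (f : k ⟶ l) : LiftsAway α a (b ≫ B.map f) :=
  fun x hx g => (h x hx (f ≫ g)).of_iso
    (whiskerLeftIso b (B.mapComp f g) ≪≫ (α_ _ _ _).symm)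

theorem isEffectiveDescent_of_lifts (hα : IsObjectwiseFullyFaithful α) (a : K)
    (hB : IsEffectiveDescent (puncturedInclusion a) B)
    (h : ∀ (X : H) (b : X ⟶ B.obj a), LiftsAway α a b → Factors (α.app a) b) :
    IsEffectiveDescent (puncturedInclusion a) A := by
  rw [isEffectiveDescent_iff] at hB ⊢
  intro S
  have hαt := hα.whisker (puncturedInclusion a)
  have := hα.faithful_postcomp (S := S)
  have := hα.full_postcomp (S := S)
  have := hαt.faithful_postcomp (S := (puncturedInclusion a).comp S)
  have := hαt.full_postcomp (S := (puncturedInclusion a).comp S)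
  have := hB S
  -- In the commuting square of restrictions and postcompositions with `α`, all sides other than
  -- restriction into `A` are known to be fully faithful, so it is too.
  have hF : (restrict (puncturedInclusion a) S A ⋙ postcomp _ (Descent.whisker _ α)).Faithful :=
    .of_iso (postcompRestrictIso (puncturedInclusion a) S α)
  have hF' : (restrict (puncturedInclusion a) S A ⋙ postcomp _ (Descent.whisker _ α)).Full :=
    .of_iso (postcompRestrictIso (puncturedInclusion a) S α)
  have : (restrict (puncturedInclusion a) S A).Faithful :=
    Functor.Faithful.of_comp _ (postcomp _ (Descent.whisker _ α))
  have : (restrict (puncturedInclusion a) S A).Full :=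
    Functor.Full.of_comp_faithful _ (postcomp _ (Descent.whisker _ α))
  have : (restrict (puncturedInclusion a) S A).EssSurj := by
    refine ⟨fun σ => ?_⟩
    -- The extension of `σ` exists with values in `B`; it remains to lift it to `A`, which is in
    -- question only at `a`.
    let φ := (restrict (puncturedInclusion a) S B).objPreimage
      (σ ≫ Descent.whisker (puncturedInclusion a) α)
    let e : Descent.whisker (puncturedInclusion a) φ ≅ σ ≫ Descent.whisker _ α :=
      (restrict (puncturedInclusion a) S B).objObjPreimageIso _
    have hφ : ∀ x : K, x ≠ a → Factors (α.app x) (φ.app x) := fun x hx =>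
      ⟨σ.app ⟨x, hx⟩, ⟨(isoApp e ⟨x, hx⟩).symm⟩⟩
    obtain ⟨σ', ⟨i⟩⟩ := hα.exists_comp_iso φ fun k => by
      by_cases hk : k = a
      · subst hk
        -- Naturality gives `φ_a ≫ B g ≅ S g ≫ φ_x`, and `φ_x` already factors through `α_x`.
        exact h _ _ fun x hx g => ((hφ x hx).precomp (S.map g)).of_iso (φ.naturality g)
      · exact hφ k hk
    exact ⟨σ', ⟨(postcomp _ (Descent.whisker (puncturedInclusion a) α)).preimageIso
      ((restrict (puncturedInclusion a) S B).mapIso i ≪≫ e)⟩⟩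
  exact { }

/-- The representing objects `L k` assemble into the universal `S` over `B` satisfying the
hypothesis of (*). Descent for `A` turns the factorisation of `S ⟶ B` through `A` away from `a` into
one everywhere. They are required at every `k`, not only at `a`, to make `S` a pseudofunctor on all
of `K`. -/
theorem factors_of_isEffectiveDescent (hα : IsObjectwiseFullyFaithful α) (a : K)
    (hB : IsEffectiveDescent (puncturedInclusion a) B)
    (hA : IsEffectiveDescent (puncturedInclusion a) A)
    (hL : ∀ k : K, ∃ (L : H) (j : L ⟶ B.obj k), IsFullyFaithfulCell j ∧
      ∀ (X : H) (b : X ⟶ B.obj k), Factors j b ↔ LiftsAway α a b)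
    {X : H} (b : X ⟶ B.obj a) (hb : LiftsAway α a b) : Factors (α.app a) b := by
  rw [isEffectiveDescent_iff] at hA hB
  choose L j hj hL using hL
  have hid : ∀ k, Factors (j k) (j k) := fun k => ⟨𝟙 _, ⟨λ_ _⟩⟩
  obtain ⟨S, β, hβ⟩ := exists_liftPseudofunctor B j hj fun {k l} f =>
    (hL l _ _).2 (((hL k _ _).1 (hid k)).comp f)
  have hβ' : ∀ k, LiftsAway α a (β.app k) := fun k =>
    (hL k _ _).1 ((hβ _ _ _).1 ⟨𝟙 _, ⟨λ_ _⟩⟩)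
  obtain ⟨σ, ⟨e⟩⟩ := (hα.whisker (puncturedInclusion a)).exists_comp_iso
    (whisker (puncturedInclusion a) β) fun x =>
      -- For `x ≠ a`, lifting away from `a` includes the identity of `x`, so `β_x` itself factors
      -- through `α_x`.
      (hβ' x.1 x.1 x.2 (𝟙 x.1)).of_iso (whiskerLeftIso _ (B.mapId x.1) ≪≫ ρ_ _)
  have := hA S
  have := hB S
  let σ' := (restrict (puncturedInclusion a) S A).objPreimage σ
  let i : whisker (puncturedInclusion a) σ' ≅ σ :=
    (restrict (puncturedInclusion a) S A).objObjPreimageIso σ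
  -- The two transformations `S ⟶ B` agree away from `a`, and full faithfulness of restriction into
  -- `B` makes them agree at `a`.
  let e' : σ' ≫ α ≅ β := (restrict (puncturedInclusion a) S B).preimageIso
    (whiskerRightIso i (whisker (puncturedInclusion a) α) ≪≫ e)
  obtain ⟨u, ⟨i⟩⟩ := (hβ a X b).2 ((hL a X b).2 hb)
  exact ⟨u ≫ σ'.app a, ⟨α_ _ _ _ ≪≫ whiskerLeftIso u (isoApp e' a) ≪≫ i⟩⟩

end Criterion

/-! ### Cones for the constant weight, in terms of legs and 2-cells. -/

section Cones

/-- A type with one element, to be seen as the terminal category. -/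
inductive Point : Type v
  | pt

instance Point.category : Category.{w} Point.{v} where
  Hom _ _ := PUnit
  id _ := ⟨⟩
  comp _ _ := ⟨⟩

instance : Subsingleton Point.{v} where
  allEq | .pt, .pt => rfl

variable {J : Type u₁} [Bicategory.{w₁, v₁} J] {H : Type u} [Bicategory.{w, v} H]

/-- The weight that is constant at the terminal category. -/
def constWeight (J : Type u₁) [Bicategory.{w₁, v₁} J] : J ⥤ᵖ Cat.{w, v} where
  obj _ := Cat.of Point
  map _ := 𝟙 _
  map₂ _ := 𝟙 _
  mapId _ := Iso.refl _
  mapComp _ _ := (λ_ _).symm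

/-- The underlying 1-cells of a cone over `F` with vertex `X`. -/
def coneLeg {F : J ⥤ᵖ H} {X : H} (c : constWeight J ⟶ F.comp (corep X)) (x : J) :
    X ⟶ F.obj x :=
  (c.app x).toFunctor.obj Point.pt

/-- The underlying invertible 2-cells of a cone over `F` with vertex `X`. -/
def coneIso {F : J ⥤ᵖ H} {X : H} (c : constWeight J ⟶ F.comp (corep X)) {x y : J}
    (f : x ⟶ y) : coneLeg c y ≅ coneLeg c x ≫ F.map f :=
  (Cat.Hom.toNatIso (c.naturality f)).app Point.pt

theorem coneIso_id {F : J ⥤ᵖ H} {X : H} (c : constWeight J ⟶ F.comp (corep X)) (x : J) :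
    (coneIso c (𝟙 x)).hom ≫ coneLeg c x ◁ (F.mapId x).hom = (ρ_ (coneLeg c x)).inv := by
  have h := congrArg (fun Θ => Θ.toNatTrans.app Point.pt) (c.naturality_id x)
  have h' : (coneIso c (𝟙 x)).hom ≫ coneLeg c x ◁ (F.mapId x).hom ≫ (ρ_ (coneLeg c x)).hom =
      (c.app x).toFunctor.map (𝟙 Point.pt) ≫ 𝟙 (coneLeg c x) ≫ 𝟙 (coneLeg c x) := h
  have e : (c.app x).toFunctor.map (𝟙 Point.pt) = 𝟙 (coneLeg c x) := (c.app x).toFunctor.map_id _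
  have h'' := h'.trans (congrArg (· ≫ 𝟙 (coneLeg c x) ≫ 𝟙 (coneLeg c x)) e)
  rw [← cancel_mono (ρ_ (coneLeg c x)).hom, Category.assoc, h'']
  exact (Category.id_comp _).trans ((Category.id_comp _).trans (Iso.inv_hom_id _).symm)

/-- The unit law determines the cone constraint at an identity, so compatibility of a cone morphism
with identity 1-cells is automatic. -/
theorem comp_coneIso_id {F : J ⥤ᵖ H} {X : H} {c c' : constWeight J ⟶ F.comp (corep X)} {x : J}
    (θ : coneLeg c x ⟶ coneLeg c' x) :
    θ ≫ (coneIso c' (𝟙 x)).hom = (coneIso c (𝟙 x)).hom ≫ θ ▷ F.map (𝟙 x) := by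
  rw [← cancel_mono (coneLeg c' x ◁ (F.mapId x).hom), Category.assoc, coneIso_id,
    Category.assoc, ← whisker_exchange, reassoc_of% coneIso_id]
  simp

/-- A cone over `F` with vertex `X`. -/
def coneMk {F : J ⥤ᵖ H} {X : H} (c : ∀ x, X ⟶ F.obj x)
    (ν : ∀ {x y : J} (f : x ⟶ y), c y ≅ c x ≫ F.map f)
    (h₂ : ∀ {x y : J} {f g : x ⟶ y} (θ : f ⟶ g), (ν g).hom = (ν f).hom ≫ c x ◁ F.map₂ θ)
    (hid : ∀ x : J, (ν (𝟙 x)).hom ≫ c x ◁ (F.mapId x).hom = (ρ_ (c x)).inv)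
    (hcomp : ∀ {x y z : J} (f : x ⟶ y) (g : y ⟶ z), (ν (f ≫ g)).hom ≫ c x ◁ (F.mapComp f g).hom =
      (ν g).hom ≫ (ν f).hom ▷ F.map g ≫ (α_ _ _ _).hom) :
    constWeight J ⟶ F.comp (corep X) where
  app x := ((Functor.const Point).obj (c x)).toCatHom
  naturality {x y} f := Cat.Hom.isoMk (NatIso.ofComponents
    (F := 𝟭 _ ⋙ (Functor.const Point).obj (c y))
    (G := (Functor.const Point).obj (c x) ⋙ postcomp X (F.map f)) (fun _ => ν f)
    (fun _ => by
      change 𝟙 _ ≫ (ν f).hom = (ν f).hom ≫ 𝟙 (c x) ▷ F.map f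
      simp))
  naturality_naturality {x y f g} θ := by
    refine Cat.Hom₂.ext (NatTrans.ext (funext fun _ => ?_))
    change 𝟙 _ ≫ (ν g).hom = (ν f).hom ≫ c x ◁ F.map₂ θ
    rw [h₂ θ, Category.id_comp]
  naturality_id x := by
    refine Cat.Hom₂.ext (NatTrans.ext (funext fun _ => ?_))
    change (ν (𝟙 x)).hom ≫ c x ◁ (F.mapId x).hom ≫ (ρ_ (c x)).hom = 𝟙 (c x) ≫ 𝟙 (c x) ≫ 𝟙 (c x)
    simp [reassoc_of% hid x]
  naturality_comp {x y z} f g := by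
    refine Cat.Hom₂.ext (NatTrans.ext (funext fun _ => ?_))
    change (ν (f ≫ g)).hom ≫ c x ◁ (F.mapComp f g).hom ≫ (α_ (c x) (F.map f) (F.map g)).inv =
      𝟙 (c z) ≫ 𝟙 (c z) ≫ (ν g).hom ≫ 𝟙 (c y ≫ F.map g) ≫ (ν f).hom ▷ F.map g ≫
        𝟙 ((c x ≫ F.map f) ≫ F.map g)
    simp [reassoc_of% hcomp f g]

/-- A morphism of cones over `F` with vertex `X`. -/
def coneHomMk {F : J ⥤ᵖ H} {X : H} {c c' : constWeight J ⟶ F.comp (corep X)}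
    (θ : ∀ x, coneLeg c x ⟶ coneLeg c' x)
    (h : ∀ {x y : J} (f : x ⟶ y),
      θ y ≫ (coneIso c' f).hom = (coneIso c f).hom ≫ θ x ▷ F.map f) : c ⟶ c' :=
  ⟨{ app := fun x => ⟨{ app := fun | .pt => θ x
                        naturality := fun
                          | .pt, .pt, u => by
                            have h₁ : (c.app x).toFunctor.map u = 𝟙 _ :=
                              (c.app x).toFunctor.map_id .pt
                            have h₂ : (c'.app x).toFunctor.map u = 𝟙 _ :=
                              (c'.app x).toFunctor.map_id .pt
                            rw [h₁, h₂]
                            exact (Category.id_comp (θ x)).trans (Category.comp_id (θ x)).symm }⟩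
     naturality := fun {x y} f => by
      refine Cat.Hom₂.ext (NatTrans.ext (funext fun | .pt => ?_))
      exact h f }⟩

/-- The components of a morphism of cones over `F`. -/
def coneHomApp {F : J ⥤ᵖ H} {X : H} {c c' : constWeight J ⟶ F.comp (corep X)}
    (Γ : c ⟶ c') (x : J) : coneLeg c x ⟶ coneLeg c' x :=
  (Γ.as.app x).toNatTrans.app Point.pt

theorem coneHomApp_naturality {F : J ⥤ᵖ H} {X : H}
    {c c' : constWeight J ⟶ F.comp (corep X)} (Γ : c ⟶ c') {x y : J} (f : x ⟶ y) :
    coneHomApp Γ y ≫ (coneIso c' f).hom = (coneIso c f).hom ≫ coneHomApp Γ x ▷ F.map f :=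
  congrArg (fun Θ => Θ.toNatTrans.app Point.pt) (Γ.as.naturality f)

theorem coneHom_ext {F : J ⥤ᵖ H} {X : H} {c c' : constWeight J ⟶ F.comp (corep X)}
    {Γ Γ' : c ⟶ c'} (h : ∀ x, coneHomApp Γ x = coneHomApp Γ' x) : Γ = Γ' :=
  Pseudofunctor.StrongTrans.homCategory.ext fun x =>
    Cat.Hom₂.ext (NatTrans.ext (funext fun | .pt => h x))

/-- The functor sending a cone to its leg at `x`. -/
def coneEval (F : J ⥤ᵖ H) (X : H) (x : J) :
    (constWeight J ⟶ F.comp (corep X)) ⥤ (X ⟶ F.obj x) where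
  obj c := coneLeg c x
  map Γ := coneHomApp Γ x

end Cones

/-! ### Intersections of pullbacks of fully faithful 1-cells, as bilimits of cospans. -/

section Shape

/-- The objects of the shape of a family of cospans with a common left end. -/
inductive CospanShape (G : Type s) : Type s
  | base
  | mid (g : G)
  | top (g : G)

namespace CospanShape

variable {G : Type s}

/-- The 1-cells of the shape of a family of cospans with a common left end: there is one from
`base` to each `mid g`, one from `top g` to `mid g`, and the identities. -/
def Hom : CospanShape G → CospanShape G → Type v
  | base, base => PUnit
  | base, mid _ => PUnit
  | mid g, mid h => ULift (PLift (g = h))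
  | top g, mid h => ULift (PLift (g = h))
  | top g, top h => ULift (PLift (g = h))
  | base, top _ => PEmpty
  | mid _, base => PEmpty
  | mid _, top _ => PEmpty
  | top _, base => PEmpty

/-- Identity 1-cells. -/
def Hom.id : (x : CospanShape G) → Hom.{s, v} x x
  | base => ⟨⟩
  | mid _ => ⟨⟨rfl⟩⟩
  | top _ => ⟨⟨rfl⟩⟩

/-- Composition of 1-cells. -/
def Hom.comp : {x y z : CospanShape G} → Hom.{s, v} x y → Hom.{s, v} y z → Hom.{s, v} x z
  | base, base, _, _, h => h
  | base, mid _, mid _, _, ⟨⟨_⟩⟩ => ⟨⟩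
  | mid _, mid _, _, ⟨⟨rfl⟩⟩, h => h
  | top _, top _, _, ⟨⟨rfl⟩⟩, h => h
  | top _, mid _, mid _, ⟨⟨rfl⟩⟩, ⟨⟨rfl⟩⟩ => ⟨⟨rfl⟩⟩
  | base, top _, _, f, _ => f.elim
  | mid _, base, _, f, _ => f.elim
  | mid _, top _, _, f, _ => f.elim
  | top _, base, _, f, _ => f.elim
  | base, mid _, base, _, h => h.elim
  | base, mid _, top _, _, h => h.elim
  | top _, mid _, base, _, h => h.elim
  | top _, mid _, top _, _, h => h.elim

instance (x y : CospanShape G) : Subsingleton (Hom.{s, v} x y) where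
  allEq f g := by
    cases x <;> cases y <;> first | exact PEmpty.elim f | (rcases f with ⟨⟨rfl⟩⟩; rfl)

instance (x y : CospanShape G) : Category.{w} (Hom.{s, v} x y) where
  Hom _ _ := PUnit
  id _ := ⟨⟩
  comp _ _ := ⟨⟩

instance bicategory : Bicategory.{w, v} (CospanShape G) where
  Hom := Hom.{s, v}
  id := Hom.id
  comp := Hom.comp
  homCategory _ _ := inferInstance
  whiskerLeft _ _ _ _ := PUnit.unit
  whiskerRight _ _ := PUnit.unit
  associator _ _ _ := ⟨PUnit.unit, PUnit.unit, rfl, rfl⟩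
  leftUnitor _ := ⟨PUnit.unit, PUnit.unit, rfl, rfl⟩
  rightUnitor _ := ⟨PUnit.unit, PUnit.unit, rfl, rfl⟩

instance strict : Strict.{w, v} (CospanShape G) where
  id_comp _ := Subsingleton.elim (α := Hom _ _) _ _
  comp_id _ := Subsingleton.elim (α := Hom _ _) _ _
  assoc _ _ _ := Subsingleton.elim (α := Hom _ _) _ _
  leftUnitor_eqToIso _ := rfl
  rightUnitor_eqToIso _ := rfl
  associator_eqToIso _ _ _ := rfl

instance isSmall : IsSmallTwoCategory.{s, w, v} (CospanShape G) where
  small_hom x y := inferInstanceAs (Small.{s} (Hom.{s, v} x y))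
  small_hom₂ _ _ := inferInstanceAs (Small.{s} PUnit.{w + 1})

variable {H : Type u} [Bicategory.{w, v} H] {Y : H} {P Q : G → H}

/-- The objects of the diagram of a family of cospans `Y ⟶ Q g ⟵ P g`. -/
def diagramObj (Y : H) (P Q : G → H) : CospanShape G → H
  | base => Y
  | mid g => Q g
  | top g => P g

/-- The 1-cells of the diagram of a family of cospans. -/
def diagramMap (p : ∀ g, Y ⟶ Q g) (q : ∀ g, P g ⟶ Q g) :
    {x y : CospanShape G} → Hom.{s, v} x y → (diagramObj Y P Q x ⟶ diagramObj Y P Q y)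
  | base, base, _ => 𝟙 Y
  | base, mid g, _ => p g
  | mid g, mid _, ⟨⟨rfl⟩⟩ => 𝟙 (Q g)
  | top g, mid _, ⟨⟨rfl⟩⟩ => q g
  | top g, top _, ⟨⟨rfl⟩⟩ => 𝟙 (P g)
  | base, top _, f => f.elim
  | mid _, base, f => f.elim
  | mid _, top _, f => f.elim
  | top _, base, f => f.elim

/-- The unit constraints of the diagram of a family of cospans. -/
def diagramMapId (p : ∀ g, Y ⟶ Q g) (q : ∀ g, P g ⟶ Q g) :
    (x : CospanShape G) → (diagramMap p q (Hom.id x) ≅ 𝟙 (diagramObj Y P Q x))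
  | base => Iso.refl (𝟙 Y)
  | mid g => Iso.refl (𝟙 (Q g))
  | top g => Iso.refl (𝟙 (P g))

/-- The composition constraints of the diagram of a family of cospans. -/
def diagramMapComp (p : ∀ g, Y ⟶ Q g) (q : ∀ g, P g ⟶ Q g) :
    {x y z : CospanShape G} → (f : Hom.{s, v} x y) → (h : Hom.{s, v} y z) →
      (diagramMap p q (f.comp h) ≅ diagramMap p q f ≫ diagramMap p q h)
  | base, base, _, _, _ => (λ_ _).symm
  | base, mid _, mid _, _, ⟨⟨rfl⟩⟩ => (ρ_ _).symm
  | mid _, mid _, _, ⟨⟨rfl⟩⟩, _ => (λ_ _).symm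
  | top _, top _, _, ⟨⟨rfl⟩⟩, _ => (λ_ _).symm
  | top _, mid _, mid _, ⟨⟨rfl⟩⟩, ⟨⟨rfl⟩⟩ => (ρ_ _).symm
  | base, top _, _, f, _ => f.elim
  | mid _, base, _, f, _ => f.elim
  | mid _, top _, _, f, _ => f.elim
  | top _, base, _, f, _ => f.elim
  | base, mid _, base, _, h => h.elim
  | base, mid _, top _, _, h => h.elim
  | top _, mid _, base, _, h => h.elim
  | top _, mid _, top _, _, h => h.elim

/-- The diagram of a family of cospans `Y ⟶ Q g ⟵ P g`. -/
def diagram (p : ∀ g, Y ⟶ Q g) (q : ∀ g, P g ⟶ Q g) :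
    Pseudofunctor.{w, w, v, v} (CospanShape G) H where
  obj := diagramObj Y P Q
  map f := diagramMap p q f
  map₂ {x y f g} _ := eqToHom (congrArg (diagramMap p q) (Subsingleton.elim (α := Hom x y) f g))
  mapId := diagramMapId p q
  mapComp f g := diagramMapComp p q f g
  map₂_whisker_left {x y z} f g h θ := by
    obtain rfl : g = h := Subsingleton.elim (α := Hom _ _) g h
    simp
  map₂_whisker_right {x y z f g} θ h := by
    obtain rfl : f = g := Subsingleton.elim (α := Hom _ _) f g
    simp
  map₂_associator {x y z t} f g h := by
    -- Of two composable 1-cells of the shape one is always an identity. Only two forms of coherence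
    -- occur: the first 1-cell is an identity, or the last two are.
    have h₁ {U V W : H} {k : U ⟶ V} {l : V ⟶ W} {m : U ⟶ W} (i : m ≅ k ≫ l) :
        𝟙 m = i.hom ≫ (λ_ k).inv ▷ l ≫ (α_ (𝟙 U) k l).hom ≫ 𝟙 U ◁ i.inv ≫ (λ_ m).hom := by
      simp
    have h₂ {U V : H} (k : U ⟶ V) : 𝟙 k = (ρ_ k).inv ≫ (ρ_ k).inv ▷ 𝟙 V ≫ (α_ k (𝟙 V) (𝟙 V)).hom ≫
        k ◁ (λ_ (𝟙 V)).hom ≫ (ρ_ k).hom := by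
      simp
    match x, y, z, t, f, g, h with
    | base, base, _, _, _, g, h => exact h₁ (diagramMapComp p q g h)
    | base, mid g, mid _, mid _, _, ⟨⟨rfl⟩⟩, ⟨⟨rfl⟩⟩ => exact h₂ (p g)
    | mid _, mid _, _, _, ⟨⟨rfl⟩⟩, g, h => exact h₁ (diagramMapComp p q g h)
    | top _, top _, _, _, ⟨⟨rfl⟩⟩, g, h => exact h₁ (diagramMapComp p q g h)
    | top g, mid _, mid _, mid _, ⟨⟨rfl⟩⟩, ⟨⟨rfl⟩⟩, ⟨⟨rfl⟩⟩ => exact h₂ (q g)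
    | base, top _, _, _, f, _, _ => exact f.elim
    | mid _, base, _, _, f, _, _ => exact f.elim
    | mid _, top _, _, _, f, _, _ => exact f.elim
    | top _, base, _, _, f, _, _ => exact f.elim
    | base, mid _, base, _, _, h, _ => exact h.elim
    | base, mid _, top _, _, _, h, _ => exact h.elim
    | top _, mid _, base, _, _, h, _ => exact h.elim
    | top _, mid _, top _, _, _, h, _ => exact h.elim
    | base, mid _, mid _, base, _, _, h => exact h.elim
    | base, mid _, mid _, top _, _, _, h => exact h.elim
    | top _, mid _, mid _, base, _, _, h => exact h.elim
    | top _, mid _, mid _, top _, _, _, h => exact h.elim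
  map₂_left_unitor {x y} f := by
    have h {U V : H} (k : U ⟶ V) : 𝟙 k = (λ_ k).inv ≫ 𝟙 (𝟙 U) ▷ k ≫ (λ_ k).hom := by simp
    match x with
    | base => exact h (diagramMap p q f)
    | mid _ => exact h (diagramMap p q f)
    | top _ => exact h (diagramMap p q f)
  map₂_right_unitor {x y} f := by
    have h₁ {U : H} : 𝟙 (𝟙 U) = (λ_ (𝟙 U)).inv ≫ 𝟙 U ◁ 𝟙 (𝟙 U) ≫ (ρ_ (𝟙 U)).hom := by
      simp
    have h₂ {U V : H} (k : U ⟶ V) : 𝟙 k = (ρ_ k).inv ≫ k ◁ 𝟙 (𝟙 V) ≫ (ρ_ k).hom := by simp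
    match x, y, f with
    | base, base, _ => exact h₁
    | base, mid g, _ => exact h₂ (p g)
    | mid _, mid _, ⟨⟨rfl⟩⟩ => exact h₁
    | top g, mid _, ⟨⟨rfl⟩⟩ => exact h₂ (q g)
    | top _, top _, ⟨⟨rfl⟩⟩ => exact h₁
    | base, top _, f => exact f.elim
    | mid _, base, f => exact f.elim
    | mid _, top _, f => exact f.elim
    | top _, base, f => exact f.elim

/-- The 1-cell from `base` to `mid g`. -/
def left (g : G) : (base : CospanShape G) ⟶ mid g :=
  (PUnit.unit : Hom.{s, v} base (mid g))

/-- The 1-cell from `top g` to `mid g`. -/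
def right (g : G) : (top g : CospanShape G) ⟶ mid g :=
  (⟨⟨rfl⟩⟩ : Hom.{s, v} (top g) (mid g))

variable {p : ∀ g, Y ⟶ Q g} {q : ∀ g, P g ⟶ Q g} {X : H}

/-- The legs of the cone over a family of cospans determined by compatible 1-cells. -/
def legs (p : ∀ g, Y ⟶ Q g) (b : X ⟶ Y) (u : ∀ g, X ⟶ P g) :
    (x : CospanShape G) → (X ⟶ diagramObj Y P Q x)
  | base => b
  | mid g => b ≫ p g
  | top g => u g

/-- The constraints of the cone over a family of cospans determined by compatible 1-cells. -/
def legsIso {b : X ⟶ Y} {u : ∀ g, X ⟶ P g} (e : ∀ g, u g ≫ q g ≅ b ≫ p g) :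
    {x y : CospanShape G} → (f : Hom.{s, v} x y) → (legs p b u y ≅ legs p b u x ≫ diagramMap p q f)
  | base, base, _ => (ρ_ _).symm
  | base, mid g, _ => Iso.refl (b ≫ p g)
  | mid _, mid _, ⟨⟨rfl⟩⟩ => (ρ_ _).symm
  | top g, mid _, ⟨⟨rfl⟩⟩ => (e g).symm
  | top _, top _, ⟨⟨rfl⟩⟩ => (ρ_ _).symm
  | base, top _, f => f.elim
  | mid _, base, f => f.elim
  | mid _, top _, f => f.elim
  | top _, base, f => f.elim

/-- The cone over a family of cospans determined by compatible 1-cells. -/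
def cone {b : X ⟶ Y} {u : ∀ g, X ⟶ P g} (e : ∀ g, u g ≫ q g ≅ b ≫ p g) :
    constWeight (CospanShape G) ⟶ (diagram p q).comp (corep X) :=
  coneMk (F := diagram p q) (legs p b u) (fun f => legsIso e f)
    (fun {x y f g} _ => by
      obtain rfl : f = g := Subsingleton.elim (α := Hom _ _) f g
      exact ((whisker_eq _ (whiskerLeft_id _ _)).trans (Category.comp_id _)).symm)
    (fun
      | base => (whisker_eq _ (whiskerLeft_id _ _)).trans (Category.comp_id _)
      | mid _ => (whisker_eq _ (whiskerLeft_id _ _)).trans (Category.comp_id _)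
      | top _ => (whisker_eq _ (whiskerLeft_id _ _)).trans (Category.comp_id _))
    (fun {x y z} f h => by
      have h₁ {U V : H} {c : X ⟶ U} {c' : X ⟶ V} {m : U ⟶ V} (i : c' ≅ c ≫ m) :
          i.hom ≫ c ◁ (λ_ m).inv = i.hom ≫ (ρ_ c).inv ▷ m ≫ (α_ c (𝟙 U) m).hom := by
        simp
      have h₂ {U V : H} {c : X ⟶ U} {c' : X ⟶ V} {m : U ⟶ V} (i : c' ≅ c ≫ m) :
          i.hom ≫ c ◁ (ρ_ m).inv = (ρ_ c').inv ≫ i.hom ▷ 𝟙 V ≫ (α_ c m (𝟙 V)).hom := by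
        simp
      match x, y, z, f, h with
      | base, base, _, _, h => exact h₁ (legsIso e h)
      | base, mid g, mid _, _, ⟨⟨rfl⟩⟩ => exact h₂ (Iso.refl (b ≫ p g))
      | mid _, mid _, _, ⟨⟨rfl⟩⟩, h => exact h₁ (legsIso e h)
      | top _, top _, _, ⟨⟨rfl⟩⟩, h => exact h₁ (legsIso e h)
      | top g, mid _, mid _, ⟨⟨rfl⟩⟩, ⟨⟨rfl⟩⟩ => exact h₂ (e g).symm
      | base, top _, _, f, _ => exact f.elim
      | mid _, base, _, f, _ => exact f.elim
      | mid _, top _, _, f, _ => exact f.elim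
      | top _, base, _, f, _ => exact f.elim
      | base, mid _, base, _, h => exact h.elim
      | base, mid _, top _, _, h => exact h.elim
      | top _, mid _, base, _, h => exact h.elim
      | top _, mid _, top _, _, h => exact h.elim)

/-- The component at `mid g` is forced by the one at `base`, and the component at `top g` is then
forced because `q g` is faithful on 2-cells. -/
theorem faithful_coneEval_base (hq : ∀ g, IsFullyFaithfulCell (q g)) :
    (coneEval (diagram p q) X (base : CospanShape G)).Faithful where
  map_injective {c c' Γ Γ'} h := by
    have hb : coneHomApp Γ base = coneHomApp Γ' base := h
    have hm (g : G) : coneHomApp Γ (mid g) = coneHomApp Γ' (mid g) := by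
      rw [← cancel_mono (coneIso c' (left.{s, v, w} g)).hom, coneHomApp_naturality,
        coneHomApp_naturality, hb]
    refine coneHom_ext fun
      | base => hb
      | mid g => hm g
      | top g => (hq g).whiskerRight_injective ?_
    have h₁ := coneHomApp_naturality Γ (right.{s, v, w} g)
    rw [hm g, coneHomApp_naturality, cancel_epi] at h₁
    exact h₁.symm

theorem full_coneEval_base (hq : ∀ g, IsFullyFaithfulCell (q g)) :
    (coneEval (diagram p q) X (base : CospanShape G)).Full where
  map_surjective {c c'} (θ : coneLeg c base ⟶ coneLeg c' base) := by
    -- Compatibility with `left g` dictates this 2-cell; its conjugate along `right g` lifts through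
    -- `q g` because `q g` is full on 2-cells.
    let θm (g : G) : coneLeg c (mid g) ⟶ coneLeg c' (mid g) :=
      (coneIso c (left.{s, v, w} g)).hom ≫ θ ▷ (diagram p q).map (left.{s, v, w} g) ≫
        (coneIso c' (left.{s, v, w} g)).inv
    let θt (g : G) : coneLeg c (top g) ⟶ coneLeg c' (top g) :=
      (hq g).lift ((coneIso c (right.{s, v, w} g)).inv ≫ θm g ≫
        (coneIso c' (right.{s, v, w} g)).hom)
    let Θ : (x : CospanShape G) → (coneLeg c x ⟶ coneLeg c' x)
      | base => θ
      | mid g => θm g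
      | top g => θt g
    refine ⟨coneHomMk Θ fun {x y} f => ?_, rfl⟩
    match x, y, f with
    | base, base, _ => exact comp_coneIso_id (Θ base)
    | base, mid g, _ =>
      exact (Iso.eq_comp_inv (coneIso c' (left.{s, v, w} g))).1 (Category.assoc _ _ _).symm
    | mid _, mid _, ⟨⟨rfl⟩⟩ => exact comp_coneIso_id (Θ (mid _))
    | top g, mid _, ⟨⟨rfl⟩⟩ =>
      have h : (coneIso c (right.{s, v, w} g)).inv ≫ θm g ≫
          (coneIso c' (right.{s, v, w} g)).hom = θt g ▷ q g :=
        ((hq g).lift_whiskerRight _).symm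
      exact (Iso.inv_comp_eq _).1 h
    | top _, top _, ⟨⟨rfl⟩⟩ => exact comp_coneIso_id (Θ (top _))
    | base, top _, f => exact f.elim
    | mid _, base, f => exact f.elim
    | mid _, top _, f => exact f.elim
    | top _, base, f => exact f.elim

end CospanShape

open CospanShape in
/-- In a bicategorically complete 2-category, the 1-cells `b : X ⟶ Y` all of whose composites with
the `p g` factor through the fully faithful `q g` are those that factor through some fully faithful
1-cell. -/
theorem exists_intersection {H : Type u} [Bicategory.{w, v} H] [BicategoricallyComplete.{s} H]
    {G : Type s} {Y : H} {P Q : G → H} (p : ∀ g, Y ⟶ Q g) (q : ∀ g, P g ⟶ Q g)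
    (hq : ∀ g, IsFullyFaithfulCell (q g)) :
    ∃ (L : H) (j : L ⟶ Y), IsFullyFaithfulCell j ∧
      ∀ (X : H) (b : X ⟶ Y), Factors j b ↔ ∀ g, Factors (q g) (b ≫ p g) := by
  obtain ⟨L, c, hc⟩ := BicategoricallyComplete.exists_bilimit (CospanShape G) (constWeight _)
    (fun _ => ⟨small_subsingleton Point.{v},
      fun _ _ => inferInstanceAs (Small.{s} PUnit.{w + 1})⟩) (diagram p q)
  refine ⟨L, coneLeg c base, fun X => ?_, fun X b => ⟨?_, fun h => ?_⟩⟩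
  -- Postcomposition with the `base` leg is the bilimit equivalence followed by evaluation at
  -- `base`.
  · have h := hc X
    have h₁ := faithful_coneEval_base hq (X := X) (p := p)
    have h₂ := full_coneEval_base hq (X := X) (p := p)
    have h₃ := Functor.Faithful.comp (coneComparison _ (diagram p q) c X)
      (coneEval (diagram p q) X base)
    have h₄ := Functor.Full.comp (coneComparison _ (diagram p q) c X)
      (coneEval (diagram p q) X base)
    exact ⟨h₄, h₃⟩
  · rintro ⟨f, ⟨i⟩⟩ g
    exact ⟨f ≫ coneLeg c (top g), ⟨α_ _ _ _ ≪≫ whiskerLeftIso f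
      ((coneIso c (right.{s, v, w} g)).symm ≪≫ coneIso c (left.{s, v, w} g)) ≪≫ (α_ _ _ _).symm ≪≫
        whiskerRightIso i (p g)⟩⟩
  · choose u e using h
    have := hc X
    -- The chosen factorisations form a cone with `base` leg `b`; it is induced by a 1-cell into the
    -- bilimit.
    let c' := cone fun g => (e g).some
    exact ⟨_, ⟨(coneEval (diagram p q) X base).mapIso
      ((coneComparison _ (diagram p q) c X).objObjPreimageIso c')⟩⟩

end Shape


/-! ### The criterion with its representing objects supplied by completeness. -/

section SmallCriterion

variable {K : Type s} [Bicategory.{w₁, v₁} K] [IsSmallTwoCategory.{s} K]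
  {H : Type u} [Bicategory.{w, v} H] [BicategoricallyComplete.{s} H]
  {A B : K ⥤ᵖ H} {α : A ⟶ B}

/-- If `α : A ⟶ B` is objectwise fully faithful and `B` is of effective descent, then `A` is of
effective descent if and only if `A a` consists of all the 1-cells into `B a` whose images under
the 1-cells from `a` to other objects lift along `α`. -/
theorem isEffectiveDescent_iff_factors (hα : IsObjectwiseFullyFaithful α) (a : K)
    (hB : IsEffectiveDescent (puncturedInclusion a) B) :
    IsEffectiveDescent (puncturedInclusion a) A ↔
      ∀ (X : H) (b : X ⟶ B.obj a), LiftsAway α a b → Factors (α.app a) b := by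
  refine ⟨fun hA X b hb => factors_of_isEffectiveDescent hα a hB hA (fun k => ?_) b hb,
    isEffectiveDescent_of_lifts hα a hB⟩
  have hs (x y : K) : Small.{s} (x ⟶ y) := IsSmallTwoCategory.small_hom x y
  -- One cospan `B k ⟶ B x ⟵ A x` for each 1-cell `k ⟶ x` with `x ≠ a`; shrinking the hom-types puts
  -- the index set in the universe covered by completeness.
  obtain ⟨L, j, hj, h⟩ := exists_intersection (G := Σ x : {x : K // x ≠ a}, Shrink.{s} (k ⟶ x.1))
    (fun g => B.map ((equivShrink _).symm g.2)) (fun g => α.app g.1.1) (fun g => hα g.1.1)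
  refine ⟨L, j, hj, fun X b => (h X b).trans ⟨fun h x hx g => ?_, fun h g => h _ g.1.2 _⟩⟩
  simpa using h ⟨⟨x, hx⟩, equivShrink _ g⟩

end SmallCriterion

/-! ### Images of pseudo-commuting squares under a pseudofunctor. -/

section Reflection

open Pseudofunctor.StrongTrans

variable {J : Type u₁} [Bicategory.{w₁, v₁} J] {H : Type u} [Bicategory.{w, v} H]

/-- The image of an invertible 2-cell in a square under a pseudofunctor. -/
def mapSquare (T : J ⥤ᵖ H) {k l k' l' : J} {f : k ⟶ l} {u : k ⟶ k'} {u' : l ⟶ l'} {f' : k' ⟶ l'}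
    (θ : f ≫ u' ≅ u ≫ f') : T.map f ≫ T.map u' ≅ T.map u ≫ T.map f' :=
  (T.mapComp f u').symm ≪≫ T.map₂Iso θ ≪≫ T.mapComp u f'

theorem naturality_mapSquare {T T' : J ⥤ᵖ H} (σ : T ⟶ T') {k l k' l' : J} {f : k ⟶ l} {u : k ⟶ k'}
    {u' : l ⟶ l'} {f' : k' ⟶ l'} (θ : f ≫ u' ≅ u ≫ f') :
    T.map f ◁ (σ.naturality u').hom ≫ (α_ _ _ _).inv ≫ (σ.naturality f).hom ▷ T'.map u' ≫
        (α_ _ _ _).hom ≫ σ.app k ◁ (mapSquare T' θ).hom ≫ (α_ _ _ _).inv =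
      ((α_ _ _ _).inv ≫ (mapSquare T θ).hom ▷ σ.app l' ≫ (α_ _ _ _).hom ≫
        T.map u ◁ (σ.naturality f').hom ≫ (α_ _ _ _).inv) ≫ (σ.naturality u).hom ▷ T'.map f' := by
  have h := σ.naturality_naturality θ.hom
  rw [naturality_comp_hom, naturality_comp_hom] at h
  rw [← cancel_epi (α_ _ _ _).hom, ← cancel_epi ((T.mapComp f u').hom ▷ σ.app l'),
    ← cancel_mono (α_ _ _ _).hom, ← cancel_mono (σ.app k ◁ (T'.mapComp u f').inv)]
  simp [mapSquare] at h ⊢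
  exact h.symm

theorem map₂_mapSquare (S : J ⥤ᵖ H) {k l k' l' : J} {f g : k ⟶ l} {u : k ⟶ k'} {u' : l ⟶ l'}
    {f' g' : k' ⟶ l'} {a : f ≫ u' ≅ u ≫ f'} {b : g ≫ u' ≅ u ≫ g'} {θ : f ⟶ g} {θ' : f' ⟶ g'}
    (h : θ ▷ u' ≫ b.hom = a.hom ≫ u ◁ θ') :
    S.map₂ θ ▷ S.map u' ≫ (mapSquare S b).hom = (mapSquare S a).hom ≫ S.map u ◁ S.map₂ θ' := by
  have h' := congrArg S.map₂ h
  simp only [S.map₂_comp, S.map₂_whisker_right, S.map₂_whisker_left, Category.assoc] at h'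
  rw [← cancel_epi (S.mapComp f u').hom, ← cancel_mono (S.mapComp u g').inv]
  simpa [mapSquare] using h'

theorem mapSquare_id (S : J ⥤ᵖ H) {k k' : J} {u : k ⟶ k'} {f' : k' ⟶ k'} {a : 𝟙 k ≫ u ≅ u ≫ f'}
    {i : f' ⟶ 𝟙 k'} (h : a.hom ≫ u ◁ i = (λ_ u).hom ≫ (ρ_ u).inv) :
    (mapSquare S a).hom ≫ S.map u ◁ (S.map₂ i ≫ (S.mapId k').hom) =
      (S.mapId k).hom ▷ S.map u ≫ (λ_ (S.map u)).hom ≫ (ρ_ (S.map u)).inv := by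
  have h' := congrArg S.map₂ h
  -- The pseudofunctor axiom concerns `(ρ_ u).hom`; the formula for the inverse follows by
  -- cancellation.
  have e : S.map₂ (ρ_ u).inv = (ρ_ (S.map u)).inv ≫ S.map u ◁ (S.mapId k').inv ≫
      (S.mapComp u (𝟙 k')).inv := by
    rw [← cancel_epi (S.map₂ (ρ_ u).hom), ← S.map₂_comp]
    simp
  simp only [S.map₂_comp, S.map₂_left_unitor, S.map₂_whisker_left, Category.assoc, e] at h'
  rw [← cancel_epi (S.mapComp (𝟙 k) u).hom, ← cancel_mono (S.map u ◁ (S.mapId k').inv),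
    ← cancel_mono (S.mapComp u (𝟙 k')).inv]
  simpa [mapSquare] using h'

theorem mapSquare_comp (S : J ⥤ᵖ H) {k l m k' l' m' : J} {f : k ⟶ l} {g : l ⟶ m} {u : k ⟶ k'}
    {u' : l ⟶ l'} {u'' : m ⟶ m'} {f' : k' ⟶ l'} {g' : l' ⟶ m'} {h' : k' ⟶ m'}
    {a : f ≫ u' ≅ u ≫ f'} {b : g ≫ u'' ≅ u' ≫ g'} {c : (f ≫ g) ≫ u'' ≅ u ≫ h'} {i : h' ⟶ f' ≫ g'}
    (h : c.hom ≫ u ◁ i = (α_ _ _ _).hom ≫ f ◁ b.hom ≫ (α_ _ _ _).inv ≫ a.hom ▷ g' ≫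
      (α_ _ _ _).hom) :
    (mapSquare S c).hom ≫ S.map u ◁ (S.map₂ i ≫ (S.mapComp f' g').hom) =
      (S.mapComp f g).hom ▷ S.map u'' ≫ (α_ _ _ _).hom ≫ S.map f ◁ (mapSquare S b).hom ≫
        (α_ _ _ _).inv ≫ (mapSquare S a).hom ▷ S.map g' ≫ (α_ _ _ _).hom := by
  have h' := congrArg S.map₂ h
  have e : S.map₂ (α_ f u' g').inv = (S.mapComp f (u' ≫ g')).hom ≫
      S.map f ◁ (S.mapComp u' g').hom ≫ (α_ _ _ _).inv ≫ (S.mapComp f u').inv ▷ S.map g' ≫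
        (S.mapComp (f ≫ u') g').inv := by
    rw [← cancel_epi (S.map₂ (α_ f u' g').hom), ← S.map₂_comp]
    simp
  simp only [S.map₂_comp, S.map₂_whisker_left, S.map₂_whisker_right, S.map₂_associator,
    e, Category.assoc] at h'
  rw [← cancel_epi (S.mapComp (f ≫ g) u'').hom, ← cancel_mono (S.map u ◁ (S.mapComp f' g').inv),
    ← cancel_mono (S.mapComp u (f' ≫ g')).inv]
  simpa [mapSquare] using h'

end Reflection

/-! ### Descent along a full inclusion, for pseudofunctors inverting a unit. -/

section Unit

open Pseudofunctor.StrongTrans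

variable {K : Type u₁} [Bicategory.{w₁, v₁} K] {H : Type u} [Bicategory.{w, v} H]
  {P : K → Prop} {r : K ⥤ᵖ FullSub P}

theorem comp_comp_mapId_hom {K₁ : Type u₁} [Bicategory.{w₁, v₁} K₁] {K₂ : Type u₂}
    [Bicategory.{w₂, v₂} K₂] {K₃ : Type u₃} [Bicategory.{w₃, v₃} K₃] (F : K₁ ⥤ᵖ K₂) (G : K₂ ⥤ᵖ K₃)
    (T : K₃ ⥤ᵖ H) (k : K₁) : ((F.comp (G.comp T)).mapId k).hom =
      T.map₂ ((F.comp G).mapId k).hom ≫ (T.mapId _).hom := by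
  change T.map₂ (G.map₂ _) ≫ T.map₂ _ ≫ _ = T.map₂ (_ ≫ _) ≫ _
  exact ((eq_whisker (T.map₂_comp _ _) _).trans (Category.assoc _ _ _)).symm

theorem comp_comp_mapComp_hom {K₁ : Type u₁} [Bicategory.{w₁, v₁} K₁] {K₂ : Type u₂}
    [Bicategory.{w₂, v₂} K₂] {K₃ : Type u₃} [Bicategory.{w₃, v₃} K₃] (F : K₁ ⥤ᵖ K₂) (G : K₂ ⥤ᵖ K₃)
    (T : K₃ ⥤ᵖ H) {k l m : K₁} (f : k ⟶ l) (g : l ⟶ m) : ((F.comp (G.comp T)).mapComp f g).hom =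
      T.map₂ ((F.comp G).mapComp f g).hom ≫ (T.mapComp _ _).hom := by
  change T.map₂ (G.map₂ _) ≫ T.map₂ _ ≫ _ = T.map₂ (_ ≫ _) ≫ _
  exact ((eq_whisker (T.map₂_comp _ _) _).trans (Category.assoc _ _ _)).symm

/-- The pseudonatural transformation `S ⟶ S ∘ r` induced by a pseudonatural transformation from the
identity to `r`. -/
def unitTrans (u : Pseudofunctor.id K ⟶ r.comp (fullInclusion P)) (S : K ⥤ᵖ H) :
    S ⟶ r.comp ((fullInclusion P).comp S) where
  app k := S.map (u.app k)
  naturality f := mapSquare S (u.naturality f)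
  naturality_naturality θ := map₂_mapSquare S (u.naturality_naturality θ)
  naturality_id k := by
    have h := mapSquare_id S (k := k) (a := u.naturality (𝟙 k)) ((u.naturality_id k).trans
      ((eq_whisker (id_whiskerRight _ _) _).trans (Category.id_comp _)))
    exact (congrArg (fun z => (mapSquare S (u.naturality (𝟙 k))).hom ≫ S.map (u.app k) ◁ z)
      (comp_comp_mapId_hom r (fullInclusion P) S k)).trans h
  naturality_comp {k l m} f g := by
    have h := mapSquare_comp S (a := u.naturality f) (b := u.naturality g)
      (c := u.naturality (f ≫ g)) ((u.naturality_comp f g).trans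
        ((eq_whisker (id_whiskerRight _ _) _).trans (Category.id_comp _)))
    exact (congrArg (fun z => (mapSquare S (u.naturality (f ≫ g))).hom ≫ S.map (u.app k) ◁ z)
      (comp_comp_mapComp_hom r (fullInclusion P) S f g)).trans h

variable {S D : K ⥤ᵖ H}

/-- Naturality of `unitTrans` with respect to pseudonatural transformations on `K`. -/
def unitTransNaturality (u : Pseudofunctor.id K ⟶ r.comp (fullInclusion P)) (φ : S ⟶ D) :
    unitTrans u S ≫ whisker r (whisker (fullInclusion P) φ) ≅ φ ≫ unitTrans u D :=
  isoMk (fun k => φ.naturality (u.app k)) (fun f => naturality_mapSquare φ (u.naturality f))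

/-- Naturality of `unitTrans` with respect to pseudonatural transformations on the full
sub-2-category. -/
def unitTransNaturalitySub (u : Pseudofunctor.id K ⟶ r.comp (fullInclusion P))
    (σ : (fullInclusion P).comp S ⟶ (fullInclusion P).comp D) :
    whisker (fullInclusion P) (unitTrans u S) ≫ whisker (fullInclusion P) (whisker r σ) ≅
      σ ≫ whisker (fullInclusion P) (unitTrans u D) :=
  isoMk (fun j => σ.naturality (InducedBicategory.mkHom (u.app ((fullInclusion P).obj j))))
    (fun {j l} f => by
      -- The image of the square under `T` and under `T` precomposed with the inclusion differ only
      -- by images of identity 2-cells from the constraints of the inclusion.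
      have h (T : K ⥤ᵖ H) : mapSquare T (u.naturality ((fullInclusion P).map f)) =
          mapSquare ((fullInclusion P).comp T) (f := f)
            (u := InducedBicategory.mkHom (u.app ((fullInclusion P).obj j)))
            (u' := InducedBicategory.mkHom (u.app ((fullInclusion P).obj l)))
            (f' := r.map ((fullInclusion P).map f))
            (InducedBicategory.isoMk (u.naturality ((fullInclusion P).map f))) := by
        refine Iso.ext ?_
        have h {k l : K} {f g : k ⟶ l} {X Y : T.obj k ⟶ T.obj l} (x : X ⟶ T.map f)
            (θ : f ⟶ g) (y : T.map g ⟶ Y) :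
            x ≫ T.map₂ θ ≫ y = (x ≫ T.map₂ (𝟙 f)) ≫ T.map₂ θ ≫ T.map₂ (𝟙 g) ≫ y := by
          simp
        exact h _ _ _
      have h' := naturality_mapSquare σ (f := f)
            (u := InducedBicategory.mkHom (u.app ((fullInclusion P).obj j)))
            (u' := InducedBicategory.mkHom (u.app ((fullInclusion P).obj l)))
            (f' := r.map ((fullInclusion P).map f))
            (InducedBicategory.isoMk (u.naturality ((fullInclusion P).map f)))
      rw [← h S, ← h D] at h'
      exact h')

/-- If `D` sends the components of a pseudonatural transformation from the identity to an
endomorphism of `K` with values in a full sub-2-category to equivalences, then `D` is determined by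
its restriction to this sub-2-category. -/
theorem isEffectiveDescent_of_unit (u : Pseudofunctor.id K ⟶ r.comp (fullInclusion P))
    -- Together with the next hypothesis this says that each `D.map (u.app k)` is an equivalence, in
    -- the form that the lifting results take.
    (hD : IsObjectwiseFullyFaithful (unitTrans u D))
    (hD' : ∀ (k : K) (Z : H) (b : Z ⟶ _), Factors ((unitTrans u D).app k) b) :
    IsEffectiveDescent (fullInclusion P) D := by
  rw [isEffectiveDescent_iff]
  intro S
  have := hD.faithful_postcomp (S := S)
  have := hD.full_postcomp (S := S)
  have hf : (restrict (fullInclusion P) S D).Faithful := ⟨fun {φ ψ Γ Γ'} h =>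
    -- Naturality at `u_k` expresses `Γ_k`, whiskered with `D u_k`, through the component at `r k`,
    -- which lies in the sub-2-category.
    homCategory.ext fun k => (hD k).whiskerRight_injective (by
      have h₀ := congrArg (fun Θ : whisker (fullInclusion P) φ ⟶ whisker (fullInclusion P) ψ =>
        Θ.as.app (r.obj k)) h
      have h₁ := Γ.as.naturality (u.app k)
      have h₂ := Γ'.as.naturality (u.app k)
      exact (cancel_epi (φ.naturality (u.app k)).hom).1 (h₁.symm.trans
        ((congrArg (fun z => S.map (u.app k) ◁ z ≫ (ψ.naturality (u.app k)).hom) h₀).trans h₂)))⟩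
  have hF : (restrict (fullInclusion P) S D).Full :=
      ⟨fun {φ ψ} (Γ : whisker (fullInclusion P) φ ⟶ whisker (fullInclusion P) ψ) => by
    -- The same formula defines the extension of `Γ`. It restricts to `Γ` because `u_j` is a 1-cell
    -- of the full sub-2-category when `j` is one of its objects, and `Γ` is natural there.
    let Θ : φ ≫ unitTrans u D ⟶ ψ ≫ unitTrans u D := (unitTransNaturality u φ).inv ≫
      unitTrans u S ◁ (restrict r _ _).map Γ ≫ (unitTransNaturality u ψ).hom
    obtain ⟨Ω, hΩ⟩ := (postcomp S (unitTrans u D)).map_surjective (X := φ) (Y := ψ) Θ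
    refine ⟨Ω, homCategory.ext fun j => (hD _).whiskerRight_injective ?_⟩
    refine (congrArg (fun Ξ : φ ≫ unitTrans u D ⟶ ψ ≫ unitTrans u D =>
      Ξ.as.app ((fullInclusion P).obj j)) hΩ).trans ?_
    exact (Iso.inv_comp_eq (φ.naturality (u.app ((fullInclusion P).obj j)))).2
      (Γ.as.naturality (InducedBicategory.mkHom (u.app ((fullInclusion P).obj j))))⟩
  have : (restrict (fullInclusion P) S D).EssSurj := ⟨fun σ => by
    -- The extension of `σ` at `k` is `S k ⟶ S (r k) ⟶ D (r k)`, pulled back along the equivalence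
    -- `D k ⟶ D (r k)`.
    obtain ⟨φ, ⟨e⟩⟩ := hD.exists_comp_iso (unitTrans u S ≫ whisker r σ) fun k => hD' k _ _
    have := (hD.whisker (fullInclusion P)).faithful_postcomp (S := (fullInclusion P).comp S)
    have := (hD.whisker (fullInclusion P)).full_postcomp (S := (fullInclusion P).comp S)
    exact ⟨φ, ⟨(postcomp ((fullInclusion P).comp S)
      (whisker (fullInclusion P) (unitTrans u D))).preimageIso
      ((restrict (fullInclusion P) S _).mapIso e ≪≫ unitTransNaturalitySub u σ)⟩⟩⟩
  exact { }

end Unit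


/-! ### The projection of `I × 2` onto the objects over `1`, and its unit. -/

section Top

variable {I : Type u₁} [Bicategory.{w₁, v₁} I]

instance Two.subsingleton_hom (i j : Two) : Subsingleton (i ⟶ j) :=
  inferInstanceAs (Subsingleton (Discrete (i.as ⟶ j.as)))

/-- The 1-cell from an object of `Two` to its terminal object. -/
def Two.toOne (i : Two) : i ⟶ ⟨1⟩ :=
  ⟨homOfLE (Fin.le_last _)⟩

theorem mk_one_ne {I : Type u₁} (b x : I) : ((x, ⟨1⟩) : I × Two) ≠ (b, ⟨0⟩) :=
  fun h => absurd (show (1 : Fin 2) = 0 from congrArg (fun p : I × Two => p.2.as) h) (by decide)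

/-- The pseudofunctor sending `(x, i)` to `(x, 1)`. -/
def toTop (b : I) : I × Two ⥤ᵖ FullSub (fun p : I × Two => p ≠ (b, ⟨0⟩)) where
  obj p := (⟨(p.1, ⟨1⟩), mk_one_ne b p.1⟩ : {p : I × Two // p ≠ (b, ⟨0⟩)})
  map f := InducedBicategory.mkHom (f.1, 𝟙 _)
  map₂ θ := InducedBicategory.mkHom₂ (θ.1, 𝟙 _)
  mapId p := InducedBicategory.isoMk (Iso.refl (𝟙 ((p.1, ⟨1⟩) : I × Two)))
  mapComp f g := InducedBicategory.isoMk (Iso.prod (Iso.refl _) (λ_ _).symm)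
  map₂_whisker_left f _ _ θ := InducedBicategory.hom₂_ext (Prod.ext (by
    change f.1 ◁ θ.1 = 𝟙 _ ≫ f.1 ◁ θ.1 ≫ 𝟙 _
    simp) (Subsingleton.elim _ _))
  map₂_whisker_right θ f := InducedBicategory.hom₂_ext (Prod.ext (by
    change θ.1 ▷ f.1 = 𝟙 _ ≫ θ.1 ▷ f.1 ≫ 𝟙 _
    simp) (Subsingleton.elim _ _))
  map₂_associator f g h := InducedBicategory.hom₂_ext (Prod.ext (by
    change (α_ f.1 g.1 h.1).hom = 𝟙 _ ≫ 𝟙 (f.1 ≫ g.1) ▷ h.1 ≫ (α_ f.1 g.1 h.1).hom ≫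
      f.1 ◁ 𝟙 (g.1 ≫ h.1) ≫ 𝟙 _
    simp) (Subsingleton.elim _ _))
  map₂_left_unitor {p q} f := InducedBicategory.hom₂_ext (Prod.ext (by
    change (λ_ f.1).hom = 𝟙 _ ≫ 𝟙 (𝟙 p.1) ▷ f.1 ≫ (λ_ f.1).hom
    simp) (Subsingleton.elim _ _))
  map₂_right_unitor {p q} f := InducedBicategory.hom₂_ext (Prod.ext (by
    change (ρ_ f.1).hom = 𝟙 _ ≫ f.1 ◁ 𝟙 (𝟙 q.1) ≫ (ρ_ f.1).hom
    simp) (Subsingleton.elim _ _))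

/-- The pseudonatural transformation with components `(x, i) ⟶ (x, 1)`. -/
def toTopUnit (b : I) : Pseudofunctor.id (I × Two) ⟶ (toTop b).comp (fullInclusion _) where
  app p := (𝟙 p.1, Two.toOne p.2)
  naturality f := Iso.prod (ρ_ f.1 ≪≫ (λ_ f.1).symm) (eqToIso (Subsingleton.elim _ _))
  naturality_naturality {p q f g} θ := Prod.ext (by
    change θ.1 ▷ 𝟙 q.1 ≫ (ρ_ g.1).hom ≫ (λ_ g.1).inv = ((ρ_ f.1).hom ≫ (λ_ f.1).inv) ≫ 𝟙 p.1 ◁ θ.1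
    simp) (Subsingleton.elim _ _)
  naturality_id p := Prod.ext (by
    change ((ρ_ (𝟙 p.1)).hom ≫ (λ_ (𝟙 p.1)).inv) ≫ 𝟙 p.1 ◁ (𝟙 (𝟙 p.1) ≫ 𝟙 (𝟙 p.1)) =
      𝟙 (𝟙 p.1) ▷ 𝟙 p.1 ≫ (λ_ (𝟙 p.1)).hom ≫ (ρ_ (𝟙 p.1)).inv
    simp) (Subsingleton.elim _ _)
  naturality_comp {p q r} f g := Prod.ext (by
    change ((ρ_ (f.1 ≫ g.1)).hom ≫ (λ_ (f.1 ≫ g.1)).inv) ≫ 𝟙 p.1 ◁ (𝟙 (f.1 ≫ g.1) ≫ 𝟙 (f.1 ≫ g.1)) =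
      𝟙 (f.1 ≫ g.1) ▷ 𝟙 r.1 ≫ (α_ f.1 g.1 (𝟙 r.1)).hom ≫ f.1 ◁ ((ρ_ g.1).hom ≫ (λ_ g.1).inv) ≫
        (α_ f.1 (𝟙 q.1) g.1).inv ≫ ((ρ_ f.1).hom ≫ (λ_ f.1).inv) ▷ g.1 ≫ (α_ (𝟙 p.1) f.1 g.1).hom
    simp) (Subsingleton.elim _ _)

end Top

/-! ### Redundancy of pure structure objects. -/

section Final

variable {H : Type u} [Bicategory.{w, v} H]

theorem isFullyFaithfulCell_id (X : H) : IsFullyFaithfulCell (𝟙 X) := fun Z => by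
  have h := isEquivalence_postcomp (X := Z) (f := 𝟙 X) ⟨Bicategory.Equivalence.id X, rfl⟩
  exact ⟨inferInstance, inferInstance⟩

theorem IsFullyFaithfulCell.of_iso {X Y : H} {f f' : X ⟶ Y} (hf : IsFullyFaithfulCell f)
    (e : f ≅ f') : IsFullyFaithfulCell f' := fun Z => by
  have h := hf Z
  have h₁ : ((postcomposing Z X Y).obj f).Full := h.1
  have h₂ : ((postcomposing Z X Y).obj f).Faithful := h.2
  exact ⟨.of_iso ((postcomposing Z X Y).mapIso e), .of_iso ((postcomposing Z X Y).mapIso e)⟩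

theorem Factors.of_iso_left {X Y Z : H} {f f' : X ⟶ Y} {b : Z ⟶ Y} (h : Factors f b) (e : f ≅ f') :
    Factors f' b :=
  let ⟨g, ⟨i⟩⟩ := h
  ⟨g, ⟨whiskerLeftIso g e.symm ≪≫ i⟩⟩

theorem factors_of_iso_id {X Z : H} {f : X ⟶ X} (e : f ≅ 𝟙 X) (b : Z ⟶ X) : Factors f b :=
  ⟨b, ⟨whiskerLeftIso b e ≪≫ ρ_ b⟩⟩

/-- The target of an irreducible 1-cell is not a pure structure object. -/
theorem IsIrreducibleCell.not_isPureStructure {K : Type u₁} [Bicategory.{w₁, v₁} K] {a b : K}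
    {f : a ⟶ b} (hf : IsIrreducibleCell f) : ¬ IsPureStructure a b := by
  rintro ⟨_, h⟩
  obtain ⟨c, k, g, hc, hk, e⟩ := h f
  -- Purity would factor `f` through some `c` different from `b`, and from `a` because `k` is
  -- irreducible; this contradicts irreducibility of `f`.
  exact hf.2 c hk.1 hc k g e

/-- A 1-cell into a pure structure object is an irreducible `f` followed by some `g'`. The target of
`f` is neither `a` nor pure, so the condition holds at `f`, and naturality of `α` carries the
factorisation along `g'`. One such step suffices, with no induction. -/
theorem liftsAway_iff_nonPure {K : Type u₁} [Bicategory.{w₁, v₁} K] {A B : K ⥤ᵖ H} (α : A ⟶ B)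
    (a : K) {X : H} (b : X ⟶ B.obj a) : LiftsAway α a b ↔
      ∀ x : K, x ≠ a → ¬ IsPureStructure a x → ∀ g : a ⟶ x, Factors (α.app x) (b ≫ B.map g) := by
  refine ⟨fun h x hx _ => h x hx, fun h x hx g => ?_⟩
  by_cases hp : IsPureStructure a x
  · obtain ⟨y, f, g', _, hf, rfl⟩ := hp.2 g
    exact ((h y hf.1 hf.not_isPureStructure f).naturality α g').of_iso
      (α_ _ _ _ ≪≫ whiskerLeftIso b (B.mapComp f g').symm)
  · exact h x hx hp g

end Final

/-! ### The criterion applied to the restricted mate. -/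

section Main

variable {K : Type u₁} [Bicategory.{w₁, v₁} K] {H : Type u} [Bicategory.{w, v} H] (a : K)
  {A B : K ⥤ᵖ H} (α : A ⟶ B)

/-- The restriction of the mate of `α` to the objects that are not pure structure objects. -/
abbrev nonPureMate : NonPure a × Two ⥤ᵖ H :=
  (prodMap (nonPureInclusion a) (Pseudofunctor.id Two)).comp (mate α)

/-- The comparison of the restricted mate of `α` with its values over `1`. -/
def nonPureMateUnit : nonPureMate a α ⟶
    (toTop (NonPure.base a)).comp ((fullInclusion _).comp (nonPureMate a α)) :=
  unitTrans (toTopUnit (NonPure.base a)) (nonPureMate a α)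

variable {α}

theorem isObjectwiseFullyFaithful_nonPureMateUnit (hα : IsObjectwiseFullyFaithful α) :
    IsObjectwiseFullyFaithful (nonPureMateUnit a α)
  | (x, ⟨0⟩) => (hα x.1).of_iso ((λ_ (α.app x.1)).symm ≪≫
      whiskerRightIso (A.mapId x.1).symm (α.app x.1))
  | (x, ⟨1⟩) => (isFullyFaithfulCell_id _).of_iso (B.mapId x.1).symm

/-- This pseudofunctor does not depend on the second coordinate: it sends each `(x, i) ⟶ (x, 1)` to
`B (𝟙 x) ≅ 𝟙`, so the unit criterion applies. -/
theorem isEffectiveDescent_top : IsEffectiveDescent (nonPureProdInclusion a)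
    ((toTop (NonPure.base a)).comp ((fullInclusion _).comp (nonPureMate a α))) :=
  isEffectiveDescent_of_unit (toTopUnit (NonPure.base a))
    (fun p => (isFullyFaithfulCell_id _).of_iso (B.mapId p.1.1).symm)
    (fun p _ b => factors_of_iso_id (B.mapId p.1.1) b)

theorem factors_zero {x : NonPure a} {X : H} {b : X ⟶ B.obj x.1} :
    Factors ((nonPureMateUnit a α).app (x, ⟨0⟩)) b ↔ Factors (α.app x.1) b :=
  have e : A.map (𝟙 x.1) ≫ α.app x.1 ≅ α.app x.1 :=
    whiskerRightIso (A.mapId x.1) (α.app x.1) ≪≫ λ_ (α.app x.1)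
  ⟨fun h => h.of_iso_left e, fun h => h.of_iso_left e.symm⟩

/-- The objects `(x, 1)` impose no condition, as the embedding is isomorphic to an identity there.
The objects `(x, 0)` with `x ≠ a` impose exactly the conditions at non-pure `x`. -/
theorem liftsAway_nonPureMateUnit_iff {X : H} (b : X ⟶ B.obj a) :
    LiftsAway (nonPureMateUnit a α) (k := ((NonPure.base a, ⟨0⟩) : NonPure a × Two))
      (NonPure.base a, ⟨0⟩) b ↔ LiftsAway α a b := by
  rw [liftsAway_iff_nonPure]
  constructor
  · intro h x hx hp g
    exact (factors_zero a (x := (⟨x, hp⟩ : {x : K // ¬ IsPureStructure a x}))).1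
      (h (⟨x, hp⟩, ⟨0⟩) (fun e => hx (congrArg (fun p : NonPure a × Two => p.1.1) e))
        (InducedBicategory.mkHom g, 𝟙 _))
  · rintro h ⟨x, ⟨i⟩⟩ hx g
    match i with
    | 0 =>
      exact (factors_zero a).2 (h x.1
        (fun e => hx (congrArg (fun y : NonPure a => ((y, ⟨0⟩) : NonPure a × Two)) (Subtype.ext e)))
        x.2 g.1.hom)
    | 1 => exact factors_of_iso_id (B.mapId x.1) _

end Main

instance {K : Type s} [Bicategory.{w, v} K] [IsSmallTwoCategory.{s} K] (a : K) :
    IsSmallTwoCategory.{s} (NonPure a × Two) where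
  small_hom p q := by
    have := IsSmallTwoCategory.small_hom p.1.1 q.1.1
    exact small_of_injective
      (f := fun f : p ⟶ q => ((f.1.hom, f.2) : (p.1.1 ⟶ q.1.1) × (p.2 ⟶ q.2)))
      fun f g h => Prod.ext (InducedBicategory.Hom.ext (Prod.ext_iff.1 h).1) (Prod.ext_iff.1 h).2
  small_hom₂ {p q} f g := by
    have := IsSmallTwoCategory.small_hom₂ f.1.hom g.1.hom
    exact small_of_injective (f := fun θ : f ⟶ g => θ.1.hom)
      fun θ θ' h => Prod.ext (InducedBicategory.hom₂_ext h) (Subsingleton.elim _ _)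

end Descent

theorem mainTheorem9 {K : Type s} [Bicategory.{w, v} K] [Bicategory.Strict K]
    [Descent.IsSmallTwoCategory.{s} K] (a : K)
    {H : Type u} [Bicategory.{w, v} H] [Bicategory.Strict H]
    [Descent.BicategoricallyComplete.{s} H]
    (A B : K ⥤ᵖ H) (α : A ⟶ B) (hα : Descent.IsObjectwiseFullyFaithful α)
    (hB : Descent.IsEffectiveDescent (Descent.puncturedInclusion a) B) :
    Descent.IsEffectiveDescent (Descent.puncturedInclusion a) A ↔
      Descent.IsEffectiveDescent (Descent.nonPureProdInclusion a)
        ((Descent.prodMap (Descent.nonPureInclusion a) (Pseudofunctor.id Descent.Two)).comp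
          (Descent.mate α)) := by
  rw [Descent.isEffectiveDescent_iff_factors hα a hB,
    Descent.isEffectiveDescent_iff_factors
      (Descent.isObjectwiseFullyFaithful_nonPureMateUnit a hα) _ (Descent.isEffectiveDescent_top a)]
  refine forall₂_congr fun X b => imp_congr ?_ ?_
  · exact (Descent.liftsAway_nonPureMateUnit_iff a b).symm
  · exact (Descent.factors_zero a (x := Descent.NonPure.base a)).symm
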